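/- Let $K$ be a field. All posets and quivers are finite; paths are composed from left to right, and $h(p)$, $t(p)$ denote the start and end vertex of a path $p$. A \emph{triangular algebra} is a quotient $\Lambda=KQ/I$, where $Q$ is a quiver without oriented cycles and $I$ is an ideal generated by linear combinations of parallel paths of length at least $2$. For a finite-dimensional $K$-algebra $A$ with a complete collection $P_1,\dots,P_n$ of pairwise non-isomorphic indecomposable projective right modules and invertible Cartan matrix $C=(\dim_K\operatorname{Hom}_A(P_i,P_j))_{i,j}$, the \emph{Coxeter polynomial} is $\phi_A(x)=\det(xI_n+C^{-1}C^T)$, i.e. the characteristic polynomial of $-C^{-1}C^T$ (if $\det C=1$, as for triangular algebras, it equals $\det(xC+C^T)$). For a poset $S$, $\phi_S$ is the Coxeter polynomial of the incidence algebra $KS$, and $\widehat S=S\cup\{\widehat 1\}$ is obtained from $S$ by adjoining an element $\widehat1$ larger than all elements of $S$. For a vertex $v$ of $Q$, put $\Lambda^-=(1-e_v)\Lambda(1-e_v)$, where $e_v$ is the idempotent of $v$. For a nonempty poset $T$, the \emph{insertion} $\Lambda\xleftarrow{v}T$ is the algebra $K\widetilde Q/\widetilde I$ defined as follows. The vertices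 of $\widetilde Q$ are those of $(Q_0\setminus\{v\})\cup T$; its arrows are the arrows of $Q$ not incident to $v$, the arrows of the Hasse quiver $Q_T$ of $T$ (an arrow $a\to b$ whenever $b$ covers $a$), an arrow $(\alpha,s)\colon h(\alpha)\to s$ for each arrow $\alpha$ of $Q$ ending at $v$ and each minimal $s\in T$, and an arrow $(s,\beta)\colon s\to t(\beta)$ for each arrow $\beta$ of $Q$ starting at $v$ and each maximal $s\in T$. For a path $p$ of $Q$ ending (starting) at $v$, let $(p,s)$ (resp. $(s,p)$) be the path obtained by replacing its last arrow $\alpha$ by $(\alpha,s)$ (its first arrow $\beta$ by $(s,\beta)$). For a path $p$ of $Q$ neither starting nor ending at $v$, let $\widetilde p=p$ if $p$ does not pass through $v$, and $\widetilde p=(p',h(q))\,q\,(t(q),p'')$ if $p=p'p''$ with $t(p')=h(p'')=v$, where $q$ is a path of $Q_T$ from a minimal to a maximal element. The ideal $\widetilde I$ is generated by (1) $\sum c_p(p,s)$ for $s\in T$ minimal and $\sum c_pp\in I$ a combination of parallel paths ending at $v$, and $\sum c_p(s,p)$ for $s\in T$ maximal and $\sum c_pp\in I$ a combination of parallel paths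 starting at $v$; (2) $q'-q''$ for parallel paths $q',q''$ of $Q_T$; $(\alpha,h(q'))q'-(\alpha,h(q''))q''$ if $h(q'),h(q'')$ are minimal and $t(q')=t(q'')$; $q'(t(q'),\beta)-q''(t(q''),\beta)$ if $t(q'),t(q'')$ are maximal and $h(q')=h(q'')$; and $(\alpha,h(q'))q'(t(q'),\beta)-(\alpha,h(q''))q''(t(q''),\beta)$ if $h(q'),h(q'')$ are minimal and $t(q'),t(q'')$ are maximal; here $q',q''$ are paths of $Q_T$, and $\alpha$, $\beta$ are arrows of $Q$ ending, respectively starting, at $v$; (3) $\sum c_p\widetilde p$ for $\sum c_pp\in I$ a combination of parallel paths neither starting nor ending at $v$ (modulo (2), $\widetilde p$ does not depend on the choice of $q$). \textbf{Statement.} For every poset $S$ (possibly empty), every triangular algebra $\Lambda=KQ/I$ and every vertex $v$ of $Q$, \[ \phi_{\Lambda\xleftarrow{v}\widehat S}(x)=\phi_\Lambda(x)\cdot\phi_S(x)+\phi_{\Lambda^-}(x)\cdot\phi_{\widehat S}(x)-(x+1)\cdot\phi_{\Lambda^-}(x)\cdot\phi_S(x). \] -/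

import Mathlib

open Quiver Polynomial

universe u w s k

/-! ### Coxeter polynomials of finite-dimensional algebras -/

namespace Coxeter

/-- An idempotent is primitive if it is nonzero and is not the sum of two nonzero orthogonal
idempotents. -/
structure IsPrimitiveIdempotent {A : Type*} [Ring A] (e : A) : Prop where
  idem : IsIdempotentElem e
  ne_zero : e ≠ 0
  indecomposable : ∀ f g : A, IsIdempotentElem f → IsIdempotentElem g →
    f * g = 0 → g * f = 0 → e = f + g → f = 0 ∨ g = 0

/-- The right `A`-module `e A` (a right `A`-module is a module over `Aᵐᵒᵖ`). -/
abbrev rightModule {A : Type*} [Ring A] (e : A) : Submodule Aᵐᵒᵖ A :=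
  Submodule.span Aᵐᵒᵖ {e}

/-- The right modules `e i A` form a complete collection of pairwise non-isomorphic
indecomposable projective right `A`-modules. (For a finite-dimensional algebra `A`, the
indecomposable projective right modules are, up to isomorphism, the modules `f A` for the
primitive idempotents `f` of `A`.) -/
structure IsCompleteProjectives {A : Type*} [Ring A] {ι : Type*} (e : ι → A) : Prop where
  primitive : ∀ i, IsPrimitiveIdempotent (e i)
  non_isomorphic : ∀ i j, Nonempty (rightModule (e i) ≃ₗ[Aᵐᵒᵖ] rightModule (e j)) → i = j
  complete : ∀ f : A, IsPrimitiveIdempotent f →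
    ∃ i, Nonempty (rightModule f ≃ₗ[Aᵐᵒᵖ] rightModule (e i))

/-- The Cartan matrix, with entries `dim_K Hom_A (P i, P j)` where `P i = e i A`. -/
noncomputable def cartanMatrix (K : Type*) {A : Type*} [Field K] [Ring A] [Algebra K A]
    {ι : Type*} (e : ι → A) : Matrix ι ι ℚ :=
  Matrix.of fun i j =>
    (Module.finrank K (rightModule (e i) →ₗ[Aᵐᵒᵖ] rightModule (e j)) : ℚ)

/-- The Coxeter polynomial of a finite-dimensional `K`-algebra `A` with invertible Cartan matrix
`C`: the characteristic polynomial of `-C⁻¹ Cᵀ`. It does not depend on the choice of the complete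
collection of indecomposable projectives, since another choice only permutes the indices. -/
noncomputable def coxeterPolynomial (K A : Type*) [Field K] [Ring A] [Algebra K A] : ℚ[X] :=
  open Classical in
  if h : ∃ p : Σ n : ℕ, (Fin n → A), IsCompleteProjectives p.2 then
    (-((cartanMatrix K h.choose.2)⁻¹ * (cartanMatrix K h.choose.2).transpose)).charpoly
  else 0

/-- The Coxeter polynomial of a finite poset: that of its incidence algebra. -/
noncomputable def posetCoxeterPolynomial (K X : Type*) [Field K] [PartialOrder X] [Fintype X] :
    ℚ[X] :=
  open Classical in
  letI : LocallyFiniteOrder X := Fintype.toLocallyFiniteOrder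
  coxeterPolynomial K (IncidenceAlgebra K X)

/-- The corner ring `e A e` of a `K`-algebra `A` is a `K`-algebra. -/
noncomputable instance cornerAlgebra {K A : Type*} [Field K] [Ring A] [Algebra K A] {e : A}
    (he : IsIdempotentElem e) : Algebra K he.Corner :=
  letI : SMul K he.Corner :=
    ⟨fun c x => ⟨c • x.1, by
      obtain ⟨y, hy⟩ := x.2
      exact ⟨c • y, by simp only [← hy, mul_smul_comm, smul_mul_assoc]⟩⟩⟩
  letI : Module K he.Corner :=
    { one_smul := fun x => Subtype.ext (one_smul K x.1)
      mul_smul := fun a b x => Subtype.ext (mul_smul a b x.1)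
      smul_zero := fun a => Subtype.ext (smul_zero a)
      smul_add := fun a x y => Subtype.ext (smul_add a x.1 y.1)
      add_smul := fun a b x => Subtype.ext (add_smul a b x.1)
      zero_smul := fun x => Subtype.ext (zero_smul K x.1) }
  Algebra.ofModule (fun r x y => Subtype.ext (smul_mul_assoc r x.1 y.1))
    (fun r x y => Subtype.ext (mul_smul_comm r x.1 y.1))

end Coxeter

/-! ### Path algebras -/

/-- The path algebra `KQ`: the `K`-vector space with basis the paths of the quiver. -/
def PathAlgebra (K : Type k) (V : Type u) [Field K] [Quiver.{w} V] : Type (max k u w) :=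
  (Σ a b : V, Path a b) →₀ K

namespace PathAlgebra

variable {K : Type k} {V : Type u} [Field K] [Quiver.{w} V]

noncomputable instance : AddCommGroup (PathAlgebra K V) :=
  inferInstanceAs (AddCommGroup ((Σ a b : V, Path a b) →₀ K))

noncomputable instance : Module K (PathAlgebra K V) :=
  inferInstanceAs (Module K ((Σ a b : V, Path a b) →₀ K))

variable (K) in
/-- A path as an element of the path algebra. -/
noncomputable def ofPath {a b : V} (p : Path a b) : PathAlgebra K V :=
  Finsupp.single (⟨a, b, p⟩ : Σ a b : V, Path a b) (1 : K)

variable (K) in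
/-- The product of two paths: their concatenation (first `p`, then `q`) if `p` ends where `q`
starts, and zero otherwise. -/
noncomputable def mulPath (p q : Σ a b : V, Path a b) : PathAlgebra K V :=
  open Classical in
  if h : q.1 = p.2.1 then ofPath K (p.2.2.comp (q.2.2.cast h rfl)) else 0

/-- The linear extension of a function on paths. -/
noncomputable def lift {M : Type*} [AddCommGroup M] [Module K M]
    (f : (Σ a b : V, Path a b) → M) : PathAlgebra K V →ₗ[K] M :=
  Finsupp.linearCombination K f

lemma lift_ofPath {M : Type*} [AddCommGroup M] [Module K M]
    (f : (Σ a b : V, Path a b) → M) {a b : V} (p : Path a b) :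
    lift f (ofPath K p) = f ⟨a, b, p⟩ :=
  (Finsupp.linearCombination_single K (1 : K) _).trans (one_smul K _)

/-- The multiplication of the path algebra: the bilinear extension of the product of paths. -/
noncomputable def mulHom : PathAlgebra K V →ₗ[K] PathAlgebra K V →ₗ[K] PathAlgebra K V :=
  lift fun p => lift fun q => mulPath K p q

noncomputable instance : Mul (PathAlgebra K V) := ⟨fun x y => mulHom x y⟩

/-- The unit of the path algebra: the sum of all trivial paths. -/
noncomputable instance [Fintype V] : One (PathAlgebra K V) :=
  ⟨∑ a : V, ofPath K (Path.nil : Path a a)⟩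

lemma mul_def (x y : PathAlgebra K V) : x * y = mulHom x y := rfl

lemma one_def [Fintype V] : (1 : PathAlgebra K V) = ∑ a : V, ofPath K (Path.nil : Path a a) := rfl

lemma ofPath_mul {a b c d : V} (p : Path a b) (q : Path c d) :
    ofPath K p * ofPath K q = mulPath K ⟨a, b, p⟩ ⟨c, d, q⟩ := by
  rw [mul_def, mulHom, lift_ofPath, lift_ofPath]

lemma ofPath_mul_comp {a b d : V} (p : Path a b) (q : Path b d) :
    ofPath K p * ofPath K q = ofPath K (p.comp q) := by
  rw [ofPath_mul]
  simp [mulPath]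

lemma ofPath_mul_of_ne {a b c d : V} (p : Path a b) (q : Path c d) (h : c ≠ b) :
    ofPath K p * ofPath K q = 0 := by
  rw [ofPath_mul]
  simp [mulPath, h]

lemma induction {motive : PathAlgebra K V → Prop} (x : PathAlgebra K V)
    (path : ∀ {a b : V} (p : Path a b), motive (ofPath K p)) (zero : motive 0)
    (add : ∀ x y, motive x → motive y → motive (x + y))
    (smul : ∀ (c : K) x, motive x → motive (c • x)) : motive x := by
  refine Finsupp.induction_linear (motive := motive) x zero (fun f g hf hg => add f g hf hg) ?_
  rintro ⟨a, b, p⟩ c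
  have h := smul c _ (path p)
  have e : c • ofPath K p = (Finsupp.single (⟨a, b, p⟩ : Σ a b : V, Path a b) c) :=
    (Finsupp.smul_single c (⟨a, b, p⟩ : Σ a b : V, Path a b) (1 : K)).trans
      (congrArg (Finsupp.single (⟨a, b, p⟩ : Σ a b : V, Path a b)) (mul_one c))
  rwa [e] at h

private lemma add_mul' (x y z : PathAlgebra K V) : (x + y) * z = x * z + y * z := by
  simp only [mul_def, map_add, LinearMap.add_apply]

private lemma mul_add' (x y z : PathAlgebra K V) : x * (y + z) = x * y + x * z := by
  simp only [mul_def, map_add]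

private lemma smul_mul' (c : K) (x y : PathAlgebra K V) : (c • x) * y = c • (x * y) := by
  simp only [mul_def, map_smul, LinearMap.smul_apply]

private lemma mul_smul' (c : K) (x y : PathAlgebra K V) : x * (c • y) = c • (x * y) := by
  simp only [mul_def, map_smul]

private lemma zero_mul' (x : PathAlgebra K V) : 0 * x = 0 := by
  simp only [mul_def, map_zero, LinearMap.zero_apply]

private lemma mul_zero' (x : PathAlgebra K V) : x * 0 = 0 := by
  simp only [mul_def, map_zero]

private lemma mul_assoc' (x y z : PathAlgebra K V) : x * y * z = x * (y * z) := by
  induction x using PathAlgebra.induction with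
  | zero => simp only [zero_mul']
  | add x x' hx hx' => simp only [add_mul', hx, hx']
  | smul c x hx => simp only [smul_mul', hx]
  | path p =>
    rename_i a b
    induction y using PathAlgebra.induction with
    | zero => simp only [zero_mul', mul_zero']
    | add y y' hy hy' => simp only [add_mul', mul_add', hy, hy']
    | smul c y hy => simp only [smul_mul', mul_smul', hy]
    | path q =>
      rename_i c d
      induction z using PathAlgebra.induction with
      | zero => simp only [mul_zero']
      | add z z' hz hz' => simp only [mul_add', hz, hz']
      | smul c z hz => simp only [mul_smul', hz]
      | path r =>
        rename_i e f
        by_cases h : c = b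
        · subst h
          by_cases h' : e = d
          · subst h'
            simp only [ofPath_mul_comp, Path.comp_assoc]
          · simp only [ofPath_mul_comp, ofPath_mul_of_ne _ _ h', mul_zero']
        · by_cases h' : e = d
          · subst h'
            simp only [ofPath_mul_comp, ofPath_mul_of_ne _ _ h, zero_mul']
          · simp only [ofPath_mul_of_ne _ _ h, ofPath_mul_of_ne _ _ h', zero_mul', mul_zero']

private lemma sum_mul' {ι : Type*} (t : Finset ι) (f : ι → PathAlgebra K V)
    (x : PathAlgebra K V) : (∑ i ∈ t, f i) * x = ∑ i ∈ t, f i * x := by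
  simp only [mul_def, map_sum, LinearMap.sum_apply]

private lemma mul_sum' {ι : Type*} (t : Finset ι) (f : ι → PathAlgebra K V)
    (x : PathAlgebra K V) : x * (∑ i ∈ t, f i) = ∑ i ∈ t, x * f i := by
  simp only [mul_def, map_sum]

private lemma one_mul' [Fintype V] (x : PathAlgebra K V) : 1 * x = x := by
  induction x using PathAlgebra.induction with
  | zero => simp only [mul_zero']
  | add x x' hx hx' => simp only [mul_add', hx, hx']
  | smul c x hx => simp only [mul_smul', hx]
  | path p =>
    rename_i a b
    rw [one_def, sum_mul', Finset.sum_eq_single a, ofPath_mul_comp, Path.nil_comp]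
    · intro c _ hc
      exact ofPath_mul_of_ne _ _ hc.symm
    · simp

private lemma mul_one' [Fintype V] (x : PathAlgebra K V) : x * 1 = x := by
  induction x using PathAlgebra.induction with
  | zero => simp only [zero_mul']
  | add x x' hx hx' => simp only [add_mul', hx, hx']
  | smul c x hx => simp only [smul_mul', hx]
  | path p =>
    rename_i a b
    rw [one_def, mul_sum', Finset.sum_eq_single b, ofPath_mul_comp, Path.comp_nil]
    · intro c _ hc
      exact ofPath_mul_of_ne _ _ hc
    · simp

noncomputable instance [Fintype V] : Ring (PathAlgebra K V) where
  left_distrib := mul_add'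
  right_distrib := add_mul'
  zero_mul := zero_mul'
  mul_zero := mul_zero'
  mul_assoc := mul_assoc'
  one_mul := one_mul'
  mul_one := mul_one'
  neg_add_cancel := neg_add_cancel
  zsmul := fun n x => n • x
  zsmul_zero' := SubNegMonoid.zsmul_zero'
  zsmul_succ' := SubNegMonoid.zsmul_succ'
  zsmul_neg' := SubNegMonoid.zsmul_neg'
  sub_eq_add_neg := sub_eq_add_neg
  nsmul := fun n x => n • x
  nsmul_zero := AddMonoid.nsmul_zero
  nsmul_succ := AddMonoid.nsmul_succ

noncomputable instance [Fintype V] : Algebra K (PathAlgebra K V) :=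
  Algebra.ofModule smul_mul' mul_smul'

end PathAlgebra

/-! ### Triangular algebras -/

namespace Triangular

open PathAlgebra

/-- `KQ/I` is a triangular algebra: the (finite) quiver `Q` has no oriented cycles, and the ideal
`I` is generated by linear combinations of parallel paths of lengths at least `2`. -/
structure IsTriangular {K : Type k} {V : Type u} [Field K] [Fintype V] [Quiver.{w} V]
    (I : TwoSidedIdeal (PathAlgebra K V)) : Prop where
  finite_arrows : ∀ a b : V, Finite (a ⟶ b)
  acyclic : ∀ (a : V) (p : Path a a), p = Path.nil
  generated : ∃ R : Set (PathAlgebra K V),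
    (∀ r ∈ R, ∃ a b : V,
      r ∈ Submodule.span K {x | ∃ p : Path a b, 2 ≤ p.length ∧ x = ofPath K p}) ∧
    I = TwoSidedIdeal.span R

section Algebras

variable {K : Type k} {V : Type u} [Field K] [Fintype V] [Quiver.{w} V]

/-- The algebra `Λ = KQ/I`. -/
abbrev quotientAlgebra (I : TwoSidedIdeal (PathAlgebra K V)) : Type (max k u w) :=
  I.ringCon.Quotient

/-- The idempotent `e_v` of `Λ = KQ/I` corresponding to a vertex `v`. -/
noncomputable def vertexIdempotent (I : TwoSidedIdeal (PathAlgebra K V)) (v : V) :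
    quotientAlgebra I :=
  I.ringCon.mk' (ofPath K (Path.nil : Path v v))

lemma isIdempotentElem_vertexIdempotent (I : TwoSidedIdeal (PathAlgebra K V)) (v : V) :
    IsIdempotentElem (vertexIdempotent I v) := by
  unfold IsIdempotentElem vertexIdempotent
  rw [← map_mul, ofPath_mul_comp, Path.comp_nil]

/-- The algebra `Λ⁻ = (1 - e_v) Λ (1 - e_v)`. -/
abbrev deletion (I : TwoSidedIdeal (PathAlgebra K V)) (v : V) : Type (max k u w) :=
  (isIdempotentElem_vertexIdempotent I v).one_sub.Corner

end Algebras

/-! ### Insertion of a poset into a triangular algebra -/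

/-- The vertex set of the Hasse quiver of a poset. -/
def Hasse (S : Type s) : Type s := S

/-- The Hasse quiver: there is one arrow `a ⟶ b` if `b` covers `a`, and none otherwise. -/
instance (S : Type s) [PartialOrder S] : Quiver.{0} (Hasse S) :=
  ⟨fun a b => PLift ((show S from a) ⋖ (show S from b))⟩

section Insertion

/-- The set `Q₀ \ {v}`. -/
def Remaining {V : Type u} (v : V) : Type u := {a : V // a ≠ v}

/-- The full subquiver of `Q` on `Q₀ \ {v}`. -/
instance {V : Type u} [Quiver.{w} V] (v : V) : Quiver.{w} (Remaining v) :=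
  ⟨fun a b => (a.1 ⟶ b.1)⟩

/-- The vertex set `(Q₀ \ {v}) ∪ S` of the quiver of the insertion of `S` at `v`. -/
def InsertionVertex {V : Type u} (v : V) (S : Type s) : Type (max u s) := Remaining v ⊕ S

noncomputable instance {V : Type u} [Fintype V] (v : V) (S : Type s) [Fintype S] :
    Fintype (InsertionVertex v S) :=
  open Classical in
  inferInstanceAs (Fintype ({a : V // a ≠ v} ⊕ S))

variable {V : Type u} [Quiver.{w} V] {v : V} {S : Type s} [PartialOrder S]

/-- The quiver `Q̃` of the insertion of `S` at `v`. Its arrows are the arrows of `Q` that neither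
start nor end at `v`, an arrow `(α, s)` for each arrow `α` ending at `v` and each minimal `s`,
an arrow `(s, β)` for each arrow `β` starting at `v` and each maximal `s`, and the arrows of the
Hasse quiver of `S`. -/
instance : Quiver.{w} (InsertionVertex v S) :=
  ⟨fun x y => match x, y with
    | Sum.inl a, Sum.inl b => (a.1 ⟶ b.1)
    | Sum.inl a, Sum.inr s => {_α : a.1 ⟶ v // IsMin s}
    | Sum.inr s, Sum.inl b => {_β : v ⟶ b.1 // IsMax s}
    | Sum.inr s, Sum.inr t => ULift.{w} (PLift (s ⋖ t))⟩

variable (S) in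
/-- A vertex of `Q` other than `v`, as a vertex of `Q̃`. -/
def old (a : Remaining v) : InsertionVertex v S := Sum.inl a

variable (v) in
/-- An element of `S`, as a vertex of `Q̃`. -/
def new (x : S) : InsertionVertex v S := Sum.inr x

/-- The inclusion of `Q \ {v}` into `Q`. -/
def toOriginal : Remaining v ⥤q V where
  obj a := a.1
  map α := α

variable (S) in
/-- The inclusion of `Q \ {v}` into `Q̃`. -/
def toInsertion : Remaining v ⥤q InsertionVertex v S where
  obj a := old S a
  map α := α

variable (v) in
/-- The inclusion of the Hasse quiver of `S` into `Q̃`. -/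
def hasseToInsertion : Hasse S ⥤q InsertionVertex v S where
  obj x := new v x
  map α := ULift.up α

/-- The arrow `(α, x)` of `Q̃`. -/
def arrowIn {a : Remaining v} (α : a.1 ⟶ v) {x : S} (hx : IsMin x) : old S a ⟶ new v x :=
  ⟨α, hx⟩

/-- The arrow `(x, β)` of `Q̃`. -/
def arrowOut {x : S} (hx : IsMax x) {b : Remaining v} (β : v ⟶ b.1) : new v x ⟶ old S b :=
  ⟨β, hx⟩

/-- Paths of `Q` from `a` to `v`, for `a ≠ v`: a path in `Q \ {v}` followed by an arrow ending
at `v` (as `Q` has no oriented cycles, such a path meets `v` only at its end). -/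
abbrev PathTo (a : Remaining v) : Type (max u w) :=
  Σ c : Remaining v, Path a c × (c.1 ⟶ v)

/-- Paths of `Q` from `v` to `b`, for `b ≠ v`: an arrow starting at `v` followed by a path in
`Q \ {v}`. -/
abbrev PathFrom (b : Remaining v) : Type (max u w) :=
  Σ c : Remaining v, (v ⟶ c.1) × Path c b

/-- Paths of `Q` from `a` to `b`, for `a, b ≠ v`: either a path in `Q \ {v}`, or the composition
of a path ending at `v` and a path starting at `v`. -/
abbrev PathBetween (a b : Remaining v) : Type (max u w) :=
  Path a b ⊕ PathTo a × PathFrom b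

/-- The path of `Q` given by an element of `PathTo`. -/
def PathTo.original {a : Remaining v} (p : PathTo a) : Path a.1 v :=
  (toOriginal.mapPath p.2.1).cons p.2.2

/-- The path of `Q` given by an element of `PathFrom`. -/
def PathFrom.original {b : Remaining v} (p : PathFrom b) : Path v b.1 :=
  p.2.1.toPath.comp (toOriginal.mapPath p.2.2)

/-- The path of `Q` given by an element of `PathBetween`. -/
def PathBetween.original {a b : Remaining v} : PathBetween a b → Path a.1 b.1
  | Sum.inl p => toOriginal.mapPath p
  | Sum.inr (p, p') => (PathTo.original p).comp (PathFrom.original p')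

/-- The path `(p, x)` of `Q̃`: the last arrow `α` of `p` is replaced by `(α, x)`. -/
def PathTo.modified {a : Remaining v} (p : PathTo a) {x : S} (hx : IsMin x) :
    Path (old S a) (new v x) :=
  ((toInsertion S).mapPath p.2.1).cons (arrowIn p.2.2 hx)

/-- The path `(x, p)` of `Q̃`: the first arrow `β` of `p` is replaced by `(x, β)`. -/
def PathFrom.modified {b : Remaining v} (p : PathFrom b) {x : S} (hx : IsMax x) :
    Path (new v x) (old S b) :=
  (arrowOut hx p.2.1).toPath.comp ((toInsertion S).mapPath p.2.2)

/-- A path in the Hasse quiver, as a path of `Q̃`. -/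
def hassePath {x y : S} (q : @Path (Hasse S) _ x y) : Path (new v x) (new v y) :=
  (hasseToInsertion v).mapPath q

/-- The path `p̃` of `Q̃` for a path `p` of `Q` that neither starts nor ends at `v`, given a maximal
path `q` of the Hasse quiver: if `p = p' p''` passes through `v` then
`p̃ = (p', x) q (y, p'')` where `q` starts at `x` and ends at `y`; otherwise `p̃ = p`. -/
def PathBetween.modified {a b : Remaining v} {x y : S} (hx : IsMin x) (hy : IsMax y)
    (q : @Path (Hasse S) _ x y) : PathBetween a b → Path (old S a) (old S b)
  | Sum.inl p => (toInsertion S).mapPath p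
  | Sum.inr (p, p') =>
    ((PathTo.modified p hx).comp (hassePath q)).comp (PathFrom.modified p' hy)

variable {K : Type k} [Field K] [Fintype V]

variable (S) in
/-- The generators of the ideal `Ĩ` of the insertion of `S` at `v`. -/
inductive InsertionRelation (I : TwoSidedIdeal (PathAlgebra K V)) (v : V) :
    PathAlgebra K (InsertionVertex v S) → Prop
  /-- The elements `∑ c_p (p, x)` for `∑ c_p p ∈ I` a combination of parallel paths ending
  at `v`. -/
  | ending {a : Remaining v} (c : PathTo a →₀ K)
      (hc : Finsupp.linearCombination K (fun p => ofPath K (PathTo.original p)) c ∈ I)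
      {x : S} (hx : IsMin x) :
      InsertionRelation I v
        (Finsupp.linearCombination K (fun p => ofPath K (PathTo.modified p hx)) c)
  /-- The elements `∑ c_p (x, p)` for `∑ c_p p ∈ I` a combination of parallel paths starting
  at `v`. -/
  | starting {b : Remaining v} (c : PathFrom b →₀ K)
      (hc : Finsupp.linearCombination K (fun p => ofPath K (PathFrom.original p)) c ∈ I)
      {x : S} (hx : IsMax x) :
      InsertionRelation I v
        (Finsupp.linearCombination K (fun p => ofPath K (PathFrom.modified p hx)) c)
  /-- The elements `q' - q''` for parallel paths of the Hasse quiver. -/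
  | commute {x y : S} (q' q'' : @Path (Hasse S) _ x y) :
      InsertionRelation I v (ofPath K (hassePath (v := v) q') - ofPath K (hassePath (v := v) q''))
  /-- The elements `(α, x') q' - (α, x'') q''`. -/
  | commute_in {a : Remaining v} (α : a.1 ⟶ v) {x' x'' y : S} (hx' : IsMin x') (hx'' : IsMin x'')
      (q' : @Path (Hasse S) _ x' y) (q'' : @Path (Hasse S) _ x'' y) :
      InsertionRelation I v
        (ofPath K ((arrowIn α hx').toPath.comp (hassePath q')) -
          ofPath K ((arrowIn α hx'').toPath.comp (hassePath q'')))
  /-- The elements `q' (y', β) - q'' (y'', β)`. -/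
  | commute_out {b : Remaining v} (β : v ⟶ b.1) {x y' y'' : S} (hy' : IsMax y') (hy'' : IsMax y'')
      (q' : @Path (Hasse S) _ x y') (q'' : @Path (Hasse S) _ x y'') :
      InsertionRelation I v
        (ofPath K ((hassePath q').cons (arrowOut hy' β)) -
          ofPath K ((hassePath q'').cons (arrowOut hy'' β)))
  /-- The elements `(α, x') q' (y', β) - (α, x'') q'' (y'', β)`. -/
  | commute_through {a b : Remaining v} (α : a.1 ⟶ v) (β : v ⟶ b.1) {x' x'' y' y'' : S}
      (hx' : IsMin x') (hx'' : IsMin x'') (hy' : IsMax y') (hy'' : IsMax y'')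
      (q' : @Path (Hasse S) _ x' y') (q'' : @Path (Hasse S) _ x'' y'') :
      InsertionRelation I v
        (ofPath K (((arrowIn α hx').toPath.comp (hassePath q')).cons (arrowOut hy' β)) -
          ofPath K (((arrowIn α hx'').toPath.comp (hassePath q'')).cons (arrowOut hy'' β)))
  /-- The elements `∑ c_p p̃` for `∑ c_p p ∈ I` a combination of parallel paths that do not start
  nor end at `v`. (Modulo the preceding relations, `p̃` does not depend on the choice of `q`.) -/
  | through {a b : Remaining v} (c : PathBetween a b →₀ K)
      (hc : Finsupp.linearCombination K (fun p => ofPath K (PathBetween.original p)) c ∈ I)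
      {x y : S} (hx : IsMin x) (hy : IsMax y) (q : @Path (Hasse S) _ x y) :
      InsertionRelation I v
        (Finsupp.linearCombination K (fun p => ofPath K (PathBetween.modified hx hy q p)) c)

variable (S) in
/-- The insertion of a nonempty finite poset `S` into `Λ = KQ/I` at the vertex `v`: the algebra
`KQ̃/Ĩ`. -/
abbrev insertion [Fintype S] (I : TwoSidedIdeal (PathAlgebra K V)) (v : V) :
    Type (max k u w s) :=
  quotientAlgebra (TwoSidedIdeal.span {x | InsertionRelation S I v x})

end Insertion

end Triangular

namespace Coxeter

/-! ### Homomorphisms between projectives and Peirce components -/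

section Peirce

variable {K A : Type*} [Field K] [Ring A] [Algebra K A]

variable (K) in
/-- The Peirce component `e A f` of an algebra, for idempotents `e` and `f`. -/
def peirce (e f : A) : Submodule K A where
  carrier := {x | e * x = x ∧ x * f = x}
  add_mem' := by
    rintro x y ⟨hx, hx'⟩ ⟨hy, hy'⟩
    exact ⟨by rw [mul_add, hx, hy], by rw [add_mul, hx', hy']⟩
  zero_mem' := ⟨mul_zero e, zero_mul f⟩
  smul_mem' := by
    rintro c x ⟨hx, hx'⟩
    exact ⟨by rw [mul_smul_comm, hx], by rw [smul_mul_assoc, hx']⟩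

lemma mul_mul_mem_peirce {e f : A} (he : IsIdempotentElem e) (hf : IsIdempotentElem f) (x : A) :
    e * x * f ∈ peirce K e f :=
  ⟨by rw [← mul_assoc, ← mul_assoc, he.eq], by rw [mul_assoc, hf.eq]⟩

lemma mem_rightModule {e : A} (he : IsIdempotentElem e) {x : A} :
    x ∈ rightModule e ↔ e * x = x := by
  rw [Submodule.mem_span_singleton]
  constructor
  · rintro ⟨a, rfl⟩
    rw [MulOpposite.smul_eq_mul_unop, ← mul_assoc, he.eq]
  · intro h
    exact ⟨MulOpposite.op x, h⟩

lemma self_mem_rightModule (e : A) : e ∈ rightModule e := Submodule.mem_span_singleton_self e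

/-- Left multiplication by an element of `f A e` is a homomorphism from `e A` to `f A`. -/
def leftMul {e f : A} (hf : IsIdempotentElem f) {x : A} (hx : f * x = x) :
    rightModule e →ₗ[Aᵐᵒᵖ] rightModule f where
  toFun z := ⟨x * z.1, (mem_rightModule hf).2 (by rw [← mul_assoc, hx])⟩
  map_add' _ _ := Subtype.ext (mul_add _ _ _)
  map_smul' a z := Subtype.ext (mul_assoc x z.1 a.unop).symm

/-- Each `z` in `e A` equals `e z`, the generator acted on by `z`, so linearity over `Aᵐᵒᵖ`
determines `φ` from its value at `e`. -/
lemma coe_hom_apply {e f : A} (he : IsIdempotentElem e)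
    (φ : rightModule e →ₗ[Aᵐᵒᵖ] rightModule f) (z : rightModule e) :
    (φ z).1 = (φ ⟨e, self_mem_rightModule e⟩).1 * z.1 := by
  have h : z = MulOpposite.op z.1 • (⟨e, self_mem_rightModule e⟩ : rightModule e) :=
    Subtype.ext ((mem_rightModule he).1 z.2).symm
  conv_lhs => rw [h, map_smul]
  rfl

/-- Homomorphisms from `e A` to `f A` are given by the elements of `f A e`. -/
def homEquivPeirce {e f : A} (he : IsIdempotentElem e) (hf : IsIdempotentElem f) :
    (rightModule e →ₗ[Aᵐᵒᵖ] rightModule f) ≃ₗ[K] peirce K f e where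
  toFun φ := ⟨(φ ⟨e, self_mem_rightModule e⟩).1, (mem_rightModule hf).1 (φ _).2,
    (coe_hom_apply he φ ⟨e, self_mem_rightModule e⟩).symm⟩
  map_add' _ _ := rfl
  map_smul' _ _ := rfl
  invFun x := leftMul hf x.2.1
  left_inv φ := LinearMap.ext fun z => Subtype.ext (coe_hom_apply he φ z).symm
  right_inv x := Subtype.ext x.2.2

variable (K) in
-- Turns isomorphisms of projectives into equations in `A`: `x` and `y` are the images of the
-- generators under the isomorphism and its inverse.
lemma nonempty_rightModule_equiv_iff {e f : A} (he : IsIdempotentElem e)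
    (hf : IsIdempotentElem f) :
    Nonempty (rightModule e ≃ₗ[Aᵐᵒᵖ] rightModule f) ↔
      ∃ x ∈ peirce K f e, ∃ y ∈ peirce K e f, x * y = f ∧ y * x = e := by
  constructor
  · rintro ⟨φ⟩
    refine ⟨_, (homEquivPeirce (K := K) he hf φ.toLinearMap).2, _,
      (homEquivPeirce (K := K) hf he φ.symm.toLinearMap).2, ?_, ?_⟩
    · refine (coe_hom_apply he φ.toLinearMap (φ.symm ⟨f, self_mem_rightModule f⟩)).symm.trans ?_
      simp
    · refine (coe_hom_apply hf φ.symm.toLinearMap (φ ⟨e, self_mem_rightModule e⟩)).symm.trans ?_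
      simp
  · rintro ⟨x, hx, y, hy, hxy, hyx⟩
    refine ⟨LinearEquiv.ofLinearMap (leftMul hf hx.1) (leftMul he hy.1) ?_ ?_⟩
    · refine LinearMap.ext fun z => Subtype.ext ?_
      change x * (y * z.1) = z.1
      rw [← mul_assoc, hxy, (mem_rightModule hf).1 z.2]
    · refine LinearMap.ext fun z => Subtype.ext ?_
      change y * (x * z.1) = z.1
      rw [← mul_assoc, hyx, (mem_rightModule he).1 z.2]

/-- The dimension of `Hom (e A, f A)` only depends on the isomorphism classes. -/
lemma finrank_hom_congr {e f e' f' : A} (φ : rightModule e ≃ₗ[Aᵐᵒᵖ] rightModule e')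
    (ψ : rightModule f ≃ₗ[Aᵐᵒᵖ] rightModule f') :
    Module.finrank K (rightModule e →ₗ[Aᵐᵒᵖ] rightModule f) =
      Module.finrank K (rightModule e' →ₗ[Aᵐᵒᵖ] rightModule f') := by
  refine LinearEquiv.finrank_eq
    { toFun := fun g => ψ.toLinearMap ∘ₗ g ∘ₗ φ.symm.toLinearMap
      invFun := fun g => ψ.symm.toLinearMap ∘ₗ g ∘ₗ φ.toLinearMap
      map_add' := fun g h => ?_
      map_smul' := fun c g => ?_
      left_inv := fun g => ?_
      right_inv := fun g => ?_ }
  · ext z; simp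
  · refine LinearMap.ext fun z => ?_
    exact (ψ.toLinearMap.map_smul_of_tower c (g (φ.symm z)))
  · ext z; simp
  · ext z; simp

end Peirce

/-! ### Triangular systems of idempotents -/

section System

variable {K A : Type*} [Field K] [Ring A] [Algebra K A] {ι : Type*} [Fintype ι]

variable (K) in
/-- A complete system of orthogonal idempotents `e i` with `e i A e i = K e i`, such that
`e i A e j` is nonzero for `i ≠ j` only if `i` has smaller rank than `j`. -/
structure IsTriangularSystem (e : ι → A) (r : ι → ℕ) : Prop where
  idem : ∀ i, IsIdempotentElem (e i)
  orthogonal : ∀ i j, i ≠ j → e i * e j = 0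
  sum_eq_one : ∑ i, e i = 1
  ne_zero : ∀ i, e i ≠ 0
  scalar : ∀ i, ∀ x ∈ peirce K (e i) (e i), ∃ c : K, x = c • e i
  rank_lt : ∀ i j, i ≠ j → ∀ x ∈ peirce K (e i) (e j), x ≠ 0 → r i < r j

namespace IsTriangularSystem

variable {e : ι → A} {r : ι → ℕ} (h : IsTriangularSystem K e r)

include h

/-- A summand of `e i` lies in `e i A e i = K e i`, and an idempotent scalar is `0` or `1`. -/
lemma primitive (i : ι) : IsPrimitiveIdempotent (e i) where
  idem := h.idem i
  ne_zero := h.ne_zero i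
  indecomposable f g hf hg hfg hgf hi := by
    have hf' : f ∈ peirce K (e i) (e i) :=
      ⟨by rw [hi, add_mul, hf.eq, hgf, add_zero], by rw [hi, mul_add, hf.eq, hfg, add_zero]⟩
    obtain ⟨c, hc⟩ := h.scalar i f hf'
    have h1 : (c * c - c) • e i = 0 := by
      have h2 := hf.eq
      rw [hc, smul_mul_smul_comm, (h.idem i).eq] at h2
      rw [sub_smul, h2, sub_self]
    have h3 : c * (c - 1) = 0 := by
      rcases smul_eq_zero.1 h1 with h2 | h2
      · rw [← h2]; ring
      · exact absurd h2 (h.ne_zero i)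
    rcases mul_eq_zero.1 h3 with h2 | h2
    · left; rw [hc, h2, zero_smul]
    · right
      rw [sub_eq_zero.1 h2, one_smul] at hc
      rw [hc] at hi
      exact left_eq_add.1 hi

/-- For `i ≠ j` the two mutually inverse elements would be nonzero in opposite Peirce components,
forcing both `r i < r j` and `r j < r i`. -/
lemma eq_of_equiv (i j : ι) (hij : Nonempty (rightModule (e i) ≃ₗ[Aᵐᵒᵖ] rightModule (e j))) :
    i = j := by
  obtain ⟨x, hx, y, hy, hxy, hyx⟩ :=
    (nonempty_rightModule_equiv_iff K (h.idem i) (h.idem j)).1 hij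
  by_contra hne
  have hx0 : x ≠ 0 := by
    rintro rfl
    exact h.ne_zero i (by rw [← hyx, mul_zero])
  have hy0 : y ≠ 0 := by
    rintro rfl
    exact h.ne_zero i (by rw [← hyx, zero_mul])
  exact lt_asymm (h.rank_lt i j hne y hy hy0) (h.rank_lt j i (Ne.symm hne) x hx hx0)

/-- With vanishing diagonal corners, `f` is strictly upper triangular for the rank, hence nilpotent,
and a nilpotent idempotent is zero. -/
lemma eq_zero_of_corner_eq_zero {f : A} (hf : IsIdempotentElem f)
    (hc : ∀ i, e i * f * e i = 0) : f = 0 := by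
  -- Descending induction on the rank: `n` bounds how far `i` lies below the maximal rank. The step
  -- writes `f = f * f` and inserts `1 = ∑ e j`; a surviving term has `r i < r j`, where `e j * f =
  -- 0` is already known.
  have key : ∀ n i, (∀ j, r j ≤ n + r i) → e i * f = 0 := by
    intro n
    induction n with
    | zero =>
      intro i hi
      rw [← mul_one (e i * f), ← h.sum_eq_one, Finset.mul_sum]
      refine Finset.sum_eq_zero fun j _ => ?_
      by_contra hne
      have hij : i ≠ j := by
        rintro rfl
        exact hne (hc i)
      have := h.rank_lt i j hij _ (mul_mul_mem_peirce (h.idem i) (h.idem j) f) hne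
      have := hi j
      omega
    | succ n ih =>
      intro i hi
      have h1 : e i * f = ∑ j, e i * f * e j * (e j * f) := by
        calc e i * f = e i * f * (∑ j, e j) * f := by
              rw [h.sum_eq_one, mul_one, mul_assoc, hf.eq]
          _ = _ := by
              rw [Finset.mul_sum, Finset.sum_mul]
              refine Finset.sum_congr rfl fun j _ => ?_
              rw [← mul_assoc, mul_assoc (e i * f) (e j) (e j), (h.idem j).eq]
      rw [h1]
      refine Finset.sum_eq_zero fun j _ => ?_
      by_cases hne : e i * f * e j = 0
      · rw [hne, zero_mul]
      have hij : i ≠ j := by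
        rintro rfl
        exact hne (hc i)
      have hlt := h.rank_lt i j hij _ (mul_mul_mem_peirce (h.idem i) (h.idem j) f) hne
      rw [ih j fun l => ?_, mul_zero]
      have := hi l
      omega
  rw [← one_mul f, ← h.sum_eq_one, Finset.sum_mul]
  -- The sum of all ranks bounds each of them, so this `n` serves every `i`.
  refine Finset.sum_eq_zero fun i _ => key (∑ j, r j) i fun j => ?_
  have := Finset.single_le_sum (f := r) (fun _ _ => Nat.zero_le _) (Finset.mem_univ j)
  omega

/-- Some `e i * f * e i` is a nonzero multiple of `e i`; after rescaling, `e i` factors as `x * y`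
through `f`. Then `y * x` is a nonzero idempotent of `f A f`, and primitivity of `f`, applied to `f
= y * x + (f - y * x)`, gives `y * x = f`. -/
lemma exists_equiv (f : A) (hf : IsPrimitiveIdempotent f) :
    ∃ i, Nonempty (rightModule f ≃ₗ[Aᵐᵒᵖ] rightModule (e i)) := by
  obtain ⟨i, hi⟩ : ∃ i, e i * f * e i ≠ 0 := by
    by_contra hcon
    push Not at hcon
    exact hf.ne_zero (h.eq_zero_of_corner_eq_zero hf.idem hcon)
  obtain ⟨c, hc⟩ := h.scalar i _ (mul_mul_mem_peirce (h.idem i) (h.idem i) f)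
  have hc0 : c ≠ 0 := by
    rintro rfl
    exact hi (by rw [hc, zero_smul])
  have hff := hf.idem.eq
  have hee := (h.idem i).eq
  have h1 : (c⁻¹ • (e i * f)) * (f * e i) = e i := by
    rw [smul_mul_assoc, mul_assoc, ← mul_assoc f f, hff, ← mul_assoc, hc, smul_smul,
      inv_mul_cancel₀ hc0, one_smul]
  have hx : c⁻¹ • (e i * f) ∈ peirce K (e i) f :=
    (peirce K (e i) f).smul_mem _ ⟨by rw [← mul_assoc, hee], by rw [mul_assoc, hff]⟩
  have hy : f * e i ∈ peirce K f (e i) := ⟨by rw [← mul_assoc, hff], by rw [mul_assoc, hee]⟩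
  set x := c⁻¹ • (e i * f)
  set y := f * e i
  have hg : IsIdempotentElem (y * x) := by
    rw [IsIdempotentElem, mul_assoc, ← mul_assoc x y x, h1, hx.1]
  have hfg : f * (y * x) = y * x := by rw [← mul_assoc, hy.1]
  have hgf : y * x * f = y * x := by rw [mul_assoc, hx.2]
  have hg0 : y * x ≠ 0 := by
    intro h0
    apply h.ne_zero i
    calc e i = x * (y * x) * y := by rw [← mul_assoc x y x, h1, hx.1, h1]
      _ = 0 := by rw [h0, mul_zero, zero_mul]
  rcases hf.indecomposable (y * x) (f - y * x) hg
    (by rw [IsIdempotentElem, sub_mul, mul_sub, mul_sub, hff, hfg, hgf, hg.eq, sub_self, sub_zero])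
    (by rw [mul_sub, hgf, hg.eq, sub_self]) (by rw [sub_mul, hfg, hg.eq, sub_self])
    (by rw [add_sub_cancel]) with h0 | h0
  · exact absurd h0 hg0
  · refine ⟨i, (nonempty_rightModule_equiv_iff K hf.idem (h.idem i)).2
      ⟨x, hx, y, hy, h1, (sub_eq_zero.1 h0).symm⟩⟩

lemma isCompleteProjectives : IsCompleteProjectives e where
  primitive := h.primitive
  non_isomorphic := h.eq_of_equiv
  complete := h.exists_equiv

end IsTriangularSystem

end System

/-! ### Independence of the chosen projectives -/

section Independence

variable {K A : Type*} [Field K] [Ring A] [Algebra K A] {ι κ : Type*}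

lemma IsCompleteProjectives.comp_equiv {e : ι → A} (he : IsCompleteProjectives e) (σ : κ ≃ ι) :
    IsCompleteProjectives (e ∘ σ) where
  primitive i := he.primitive _
  non_isomorphic i j h := σ.injective (he.non_isomorphic _ _ h)
  complete f hf := by
    obtain ⟨i, hi⟩ := he.complete f hf
    obtain ⟨j, rfl⟩ := σ.surjective i
    exact ⟨j, hi⟩

/-- Two complete collections of projectives agree up to isomorphism and a permutation. -/
lemma IsCompleteProjectives.exists_equiv {e : ι → A} {f : κ → A} (he : IsCompleteProjectives e)
    (hf : IsCompleteProjectives f) :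
    ∃ σ : ι ≃ κ, ∀ i, Nonempty (rightModule (e i) ≃ₗ[Aᵐᵒᵖ] rightModule (f (σ i))) := by
  choose σ hσ using fun i => hf.complete (e i) (he.primitive i)
  choose τ hτ using fun j => he.complete (f j) (hf.primitive j)
  refine ⟨⟨σ, τ, fun i => ?_, fun j => ?_⟩, hσ⟩
  · exact (he.non_isomorphic _ _ ⟨(hσ i).some.trans (hτ (σ i)).some⟩).symm
  · exact (hf.non_isomorphic _ _ ⟨(hτ j).some.trans (hσ (τ j)).some⟩).symm

variable (K) in
lemma IsCompleteProjectives.exists_cartanMatrix_eq {e : ι → A} {f : κ → A}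
    (he : IsCompleteProjectives e) (hf : IsCompleteProjectives f) :
    ∃ σ : ι ≃ κ, cartanMatrix K f = Matrix.reindex σ σ (cartanMatrix K e) := by
  obtain ⟨σ, hσ⟩ := he.exists_equiv hf
  refine ⟨σ, Matrix.ext fun i j => ?_⟩
  obtain ⟨i, rfl⟩ := σ.surjective i
  obtain ⟨j, rfl⟩ := σ.surjective j
  simp only [cartanMatrix, Matrix.reindex_apply, Matrix.submatrix_apply, Matrix.of_apply,
    Equiv.symm_apply_apply]
  rw [finrank_hom_congr (hσ i).some (hσ j).some]

/-- The definition uses an unspecified collection indexed by `Fin n`. Any other has the same Cartan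
matrix up to a simultaneous permutation of rows and columns, which preserves the characteristic
polynomial. -/
lemma coxeterPolynomial_eq_charpoly [Fintype ι] [DecidableEq ι] {e : ι → A}
    (he : IsCompleteProjectives e) :
    coxeterPolynomial K A =
      (-((cartanMatrix K e)⁻¹ * (cartanMatrix K e).transpose)).charpoly := by
  have h : ∃ p : Σ n : ℕ, (Fin n → A), IsCompleteProjectives p.2 :=
    ⟨⟨Fintype.card ι, e ∘ (Fintype.equivFin ι).symm⟩, he.comp_equiv _⟩
  rw [coxeterPolynomial, dif_pos h]
  obtain ⟨σ, hσ⟩ := he.exists_cartanMatrix_eq K h.choose_spec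
  rw [hσ, Matrix.inv_reindex, Matrix.transpose_reindex, Matrix.reindex_apply, Matrix.reindex_apply,
    Matrix.submatrix_mul_equiv]
  exact Matrix.charpoly_reindex σ (-((cartanMatrix K e)⁻¹ * (cartanMatrix K e).transpose))

end Independence

/-! ### The Coxeter polynomial as the determinant of a pencil -/

section Peirce

variable {K A : Type*} [Field K] [Ring A] [Algebra K A] {ι : Type*}

/-- The matrix of the dimensions of the Peirce components `e i A e j`; it is the transpose of the
Cartan matrix. -/
noncomputable def dimMatrix (K : Type*) {A : Type*} [Field K] [Ring A] [Algebra K A] {ι : Type*}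
    (e : ι → A) : Matrix ι ι ℚ :=
  Matrix.of fun i j => (Module.finrank K (peirce K (e i) (e j)) : ℚ)

/-- The polynomial `det (x Dᵀ + D)`. -/
noncomputable def pencilDet [Fintype ι] [DecidableEq ι] (D : Matrix ι ι ℚ) : ℚ[X] :=
  ((X : ℚ[X]) • (D.map C).transpose + D.map C).det

variable [Fintype ι] {e : ι → A} {r : ι → ℕ}

lemma IsTriangularSystem.finrank_self (h : IsTriangularSystem K e r) (i : ι) :
    Module.finrank K (peirce K (e i) (e i)) = 1 := by
  refine finrank_eq_one (⟨e i, h.idem i, h.idem i⟩ : peirce K (e i) (e i))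
    (fun h0 => h.ne_zero i (congrArg Subtype.val h0)) fun x => ?_
  obtain ⟨c, hc⟩ := h.scalar i x.1 x.2
  exact ⟨c, Subtype.ext hc.symm⟩

lemma IsTriangularSystem.finrank_eq_zero (h : IsTriangularSystem K e r) {i j : ι} (hij : i ≠ j)
    (hr : r j ≤ r i) : Module.finrank K (peirce K (e i) (e j)) = 0 := by
  have : peirce K (e i) (e j) = ⊥ := by
    refine (Submodule.eq_bot_iff _).2 fun x hx => ?_
    by_contra hx0
    exact absurd (h.rank_lt i j hij x hx hx0) (not_lt.2 hr)
  rw [this, finrank_bot]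

/-- Grouping indices by rank makes the matrix block triangular, and distinct indices of equal rank
have zero Peirce component, so the diagonal blocks are identity matrices. -/
lemma IsTriangularSystem.det_dimMatrix [DecidableEq ι] (h : IsTriangularSystem K e r) :
    (dimMatrix K e).det = 1 := by
  have ht : (dimMatrix K e).BlockTriangular r := fun i j hij => by
    have hne : i ≠ j := by rintro rfl; exact lt_irrefl _ hij
    simp only [dimMatrix, Matrix.of_apply, h.finrank_eq_zero hne hij.le, Nat.cast_zero]
  rw [ht.det]
  refine Finset.prod_eq_one fun n _ => ?_
  have : (dimMatrix K e).toSquareBlock r n = 1 := by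
    ext ⟨i, hi⟩ ⟨j, hj⟩
    simp only [Matrix.toSquareBlock_def, Matrix.of_apply, dimMatrix, Matrix.one_apply,
      Subtype.mk.injEq]
    split_ifs with hij
    · subst hij; rw [h.finrank_self, Nat.cast_one]
    · rw [h.finrank_eq_zero hij (by rw [hi, hj]), Nat.cast_zero]
  rw [this, Matrix.det_one]

/-- The Cartan matrix `Dᵀ` has determinant `1`; multiplying `det (x + (Dᵀ)⁻¹ D)` by it clears the
inverse. -/
lemma IsTriangularSystem.coxeterPolynomial_eq [DecidableEq ι] (h : IsTriangularSystem K e r) :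
    coxeterPolynomial K A = pencilDet (dimMatrix K e) := by
  have hC : cartanMatrix K e = (dimMatrix K e).transpose := by
    ext i j
    simp only [cartanMatrix, dimMatrix, Matrix.of_apply, Matrix.transpose_apply]
    rw [(homEquivPeirce (K := K) (h.idem i) (h.idem j)).finrank_eq]
  rw [coxeterPolynomial_eq_charpoly h.isCompleteProjectives, hC, Matrix.transpose_transpose,
    pencilDet, Matrix.charpoly, Matrix.charmatrix]
  set D := dimMatrix K e
  have hD : D.transpose.det = 1 := by rw [Matrix.det_transpose, h.det_dimMatrix]
  have hDC : ((D.map C).transpose : Matrix ι ι ℚ[X]).det = 1 := by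
    rw [← Matrix.transpose_map, ← RingHom.mapMatrix_apply, ← RingHom.map_det, hD, map_one]
  rw [← one_mul (Matrix.det _), ← hDC, ← Matrix.det_mul]
  congr 1
  have h1 : (D.map C).transpose * (D.transpose⁻¹ * D).map C = D.map C := by
    rw [← Matrix.transpose_map, ← Matrix.map_mul, ← mul_assoc,
      Matrix.mul_nonsing_inv _ (by rw [hD]; exact isUnit_one), one_mul]
  have h2 : C.mapMatrix (-(D.transpose⁻¹ * D)) = -((D.transpose⁻¹ * D).map C) := by
    rw [map_neg]; rfl
  rw [h2, sub_neg_eq_add, mul_add, h1]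
  congr 1
  rw [Matrix.scalar_apply, ← Matrix.smul_one_eq_diagonal, mul_smul_comm, mul_one]

end Peirce

/-! ### Determinants of bordered matrices -/

section Bordered

variable {R : Type*} [CommRing R] {m n : Type*} [Fintype m] [Fintype n] [DecidableEq m]
  [DecidableEq n]

/-- The matrix `A` bordered by a column `p`, a row `q` and the corner entry `d`. -/
def bordered {R m : Type*} (A : Matrix m m R) (p q : m → R) (d : R) :
    Matrix (m ⊕ Unit) (m ⊕ Unit) R :=
  Matrix.fromBlocks A (Matrix.of fun i _ => p i) (Matrix.of fun _ j => q j) (Matrix.of fun _ _ => d)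

/-- The determinant is linear in the last row, whose entries are `q` and `d`. -/
lemma det_bordered_add (A : Matrix m m R) (p q q' : m → R) (d d' : R) :
    (bordered A p (q + q') (d + d')).det = (bordered A p q d).det + (bordered A p q' d').det := by
  have key : ∀ (a : m → R) (b : R), bordered A p a b =
      (bordered A p 0 0).updateRow (Sum.inr ()) (Sum.elim a fun _ => b) := by
    intro a b
    ext (i | i) (j | j) <;> simp [bordered, Matrix.updateRow_apply]
  rw [key, key q, key q', ← Matrix.det_updateRow_add]
  congr 2
  ext (j | j) <;> rfl

lemma det_bordered_zero_row (A : Matrix m m R) (p : m → R) (d : R) :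
    (bordered A p 0 d).det = A.det * d := by
  have : (Matrix.of fun (_ : Unit) j => (0 : m → R) j) = 0 := rfl
  rw [bordered, this, Matrix.det_fromBlocks_zero₂₁, Matrix.det_unique (n := Unit), Matrix.of_apply]

/-- Linearity in the last row isolates the contribution of the corner entry. This produces the
correction term with factor `x + 1` in the final formula. -/
lemma det_bordered_zero_corner (A : Matrix m m R) (p q : m → R) (d : R) :
    (bordered A p q 0).det = (bordered A p q d).det - d * A.det := by
  have h := det_bordered_add A p q 0 0 d
  rw [det_bordered_zero_row, add_zero, zero_add] at h
  rw [h]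
  ring

/-- Subtracting multiples of the last column from the other columns and then multiples of the last
row from the other rows. -/
lemma det_bordered_eq (A : Matrix m m R) (p q c : m → R) (d : R) :
    (bordered A p q d).det =
      (bordered (A - Matrix.vecMulVec p c - Matrix.vecMulVec c (q - d • c)) (p - d • c)
        (q - d • c) d).det := by
  -- The outer factors are unitriangular and undo the row and column operations, so they do not
  -- change the determinant.
  have h : bordered A p q d =
      Matrix.fromBlocks 1 (Matrix.of fun i _ => c i) 0 1 *
        bordered (A - Matrix.vecMulVec p c - Matrix.vecMulVec c (q - d • c)) (p - d • c)
          (q - d • c) d *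
        Matrix.fromBlocks 1 0 (Matrix.of fun _ j => c j) 1 := by
    rw [bordered, bordered, Matrix.fromBlocks_multiply, Matrix.fromBlocks_multiply]
    congr 1
    · ext i j
      simp [Matrix.mul_apply, Matrix.vecMulVec_apply]
      ring
    · ext i j
      simp [Matrix.mul_apply]
      ring
    · ext i j
      simp [Matrix.mul_apply]
    · ext i j
      simp
  rw [h, Matrix.det_mul, Matrix.det_mul, Matrix.det_fromBlocks_zero₂₁,
    Matrix.det_fromBlocks_zero₁₂]
  simp

/-- The last row vanishes on the columns of `B`. Moving the border index next to the first block
therefore gives a block triangular matrix, in which `b` does not contribute. -/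
lemma det_bordered_fromBlocks_left (A : Matrix m m R) (B : Matrix n n R) (p q : m → R)
    (b : n → R) (d : R) :
    (bordered (Matrix.fromBlocks A 0 0 B) (Sum.elim p b) (Sum.elim q 0) d).det =
      (bordered A p q d).det * B.det := by
  let σ : (m ⊕ Unit) ⊕ n ≃ (m ⊕ n) ⊕ Unit :=
    (Equiv.sumAssoc m Unit n).trans (((Equiv.refl m).sumCongr (Equiv.sumComm Unit n)).trans
      (Equiv.sumAssoc m n Unit).symm)
  rw [← Matrix.det_submatrix_equiv_self σ,
    ← Matrix.det_fromBlocks_zero₂₁ (bordered A p q d) 0 B, ← Matrix.det_transpose,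
    ← Matrix.det_transpose (Matrix.fromBlocks _ _ _ _)]
  have h : (bordered (Matrix.fromBlocks A 0 0 B) (Sum.elim p b) (Sum.elim q 0) d).submatrix σ σ =
      Matrix.fromBlocks (bordered A p q d) 0
        (Matrix.of fun i => Sum.elim 0 fun _ => b i) B := by
    ext ((i | i) | i) ((j | j) | j) <;> rfl
  rw [h, Matrix.det_transpose, Matrix.det_transpose, Matrix.det_fromBlocks_zero₁₂,
    Matrix.det_fromBlocks_zero₂₁]

lemma det_bordered_fromBlocks_right (A : Matrix m m R) (B : Matrix n n R) (p : m → R)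
    (b c : n → R) (d : R) :
    (bordered (Matrix.fromBlocks A 0 0 B) (Sum.elim p b) (Sum.elim 0 c) d).det =
      A.det * (bordered B b c d).det := by
  let σ : (n ⊕ m) ⊕ Unit ≃ (m ⊕ n) ⊕ Unit := (Equiv.sumComm n m).sumCongr (Equiv.refl Unit)
  rw [← Matrix.det_submatrix_equiv_self σ, mul_comm, ← det_bordered_fromBlocks_left B A b c p]
  congr 1
  ext ((i | i) | i) ((j | j) | j) <;> rfl

/-- The last row `(q, c, d)` is split as `(q, 0, d') + (0, c, d - d')`; each summand ignores one of
the diagonal blocks in the border. -/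
lemma det_bordered_fromBlocks (A : Matrix m m R) (B : Matrix n n R) (p q : m → R)
    (b c : n → R) (d d' : R) :
    (bordered (Matrix.fromBlocks A 0 0 B) (Sum.elim p b) (Sum.elim q c) d).det =
      (bordered A p q d').det * B.det + A.det * (bordered B b c (d - d')).det := by
  rw [← det_bordered_fromBlocks_left A B p q b, ← det_bordered_fromBlocks_right A B p,
    ← det_bordered_add]
  congr 2
  · ext (i | i) <;> simp
  · ring

end Bordered

/-! ### The pencil of a blown-up matrix -/

section Pencil

variable {m n : Type*} [Fintype m] [Fintype n] [DecidableEq m] [DecidableEq n]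

lemma pencilDet_submatrix (D : Matrix m m ℚ) (σ : n ≃ m) :
    pencilDet (D.submatrix σ σ) = pencilDet D := by
  rw [pencilDet, pencilDet, ← Matrix.det_submatrix_equiv_self σ]
  rfl

/-- The pencil `x Dᵀ + D`. -/
noncomputable def pencil {m : Type*} (D : Matrix m m ℚ) : Matrix m m ℚ[X] :=
  (X : ℚ[X]) • (D.map C).transpose + D.map C

lemma pencilDet_eq (D : Matrix m m ℚ) : pencilDet D = (pencil D).det := rfl

lemma pencil_bordered {m : Type*} (D : Matrix m m ℚ) (p q : m → ℚ) :
    pencil (bordered D p q 1) = bordered (pencil D) (fun i => X * C (q i) + C (p i))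
      (fun i => X * C (p i) + C (q i)) (X + 1) := by
  ext1 (i | i) (j | j) <;> simp [pencil, bordered]

/-- The formula for the determinant of the pencil of the matrix which arises by blowing up the
last index of a bordered matrix. -/
theorem pencilDet_insertion (M : Matrix m m ℚ) (p q : m → ℚ) (Z : Matrix n n ℚ) :
    pencilDet (bordered (Matrix.fromBlocks M (Matrix.of fun i _ => p i) (Matrix.of fun _ j => q j) Z)
        (Sum.elim p 1) (Sum.elim q 0) 1) =
      pencilDet (bordered M p q 1) * pencilDet Z +
        pencilDet M * pencilDet (bordered Z 1 0 1) - (X + 1) * pencilDet M * pencilDet Z := by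
  simp only [pencilDet_eq, pencil_bordered]
  -- The rows and columns of `Z` copy the border outside `Z`. Taking `c` equal to `1` on these
  -- indices and `0` elsewhere cancels both off-diagonal blocks. The block of `Z` is left unchanged
  -- and its borders become `-X` and `-1`.
  rw [det_bordered_eq (pencil (Matrix.fromBlocks M _ _ Z)) _ _ (Sum.elim 0 1),
    det_bordered_eq (pencil Z) _ _ 1]
  set p' : m → ℚ[X] := fun i => X * C (q i) + C (p i)
  set q' : m → ℚ[X] := fun i => X * C (p i) + C (q i)
  -- The whole corner entry `X + 1` goes to the first summand, leaving corner `0` in the second.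
  have h1 := det_bordered_fromBlocks (pencil M) (pencil Z) p' q' (fun _ => -X) (fun _ => -1)
    (X + 1) (X + 1)
  rw [sub_self, det_bordered_zero_corner _ _ _ (X + 1)] at h1
  convert h1 using 1
  · congr 2
    · ext1 (i | i) (j | j) <;> simp [pencil, Matrix.vecMulVec_apply]
    · ext1 (i | i) <;> simp [p']
    · ext1 (i | i) <;> simp [q']
  -- The same operations on the pencil of `Z` with its top element adjoined give the same borders,
  -- which identifies the second summand.
  · have h2 : (bordered (pencil Z - Matrix.vecMulVec (fun i => X * C ((0 : n → ℚ) i) +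
        C ((1 : n → ℚ) i)) 1 - Matrix.vecMulVec 1 ((fun i => X * C ((1 : n → ℚ) i) +
        C ((0 : n → ℚ) i)) - (X + 1 : ℚ[X]) • 1)) ((fun i => X * C ((0 : n → ℚ) i) +
        C ((1 : n → ℚ) i)) - (X + 1 : ℚ[X]) • 1) ((fun i => X * C ((1 : n → ℚ) i) +
        C ((0 : n → ℚ) i)) - (X + 1 : ℚ[X]) • 1) (X + 1)) =
        bordered (pencil Z) (fun _ => -X) (fun _ => -1) (X + 1) := by
      congr 1
      · ext1 i j
        simp
      · ext1 i
        simp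
      · ext1 i
        simp
    rw [h2]
    ring

end Pencil

/-! ### Incidence algebras -/

section Incidence

variable (K : Type*) {T : Type*} [Field K] [PartialOrder T] [DecidableEq T]

/-- The element of the incidence algebra supported at a pair `s ≤ t`. -/
def incidenceSingle {s t : T} (hst : s ≤ t) : IncidenceAlgebra K T :=
  ⟨fun a b => if a = s ∧ b = t then 1 else 0, fun a b hab =>
    if_neg (by rintro ⟨rfl, rfl⟩; exact hab hst)⟩

lemma incidenceSingle_apply {s t : T} (hst : s ≤ t) (a b : T) :
    incidenceSingle K hst a b = if a = s ∧ b = t then 1 else 0 := rfl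

variable [LocallyFiniteOrder T]

lemma incidenceSingle_mul_apply (s : T) (f : IncidenceAlgebra K T) (a b : T) :
    (incidenceSingle K (le_refl s) * f) a b = if a = s then f s b else 0 := by
  rw [IncidenceAlgebra.mul_apply]
  split_ifs with h
  · subst h
    by_cases hab : a ≤ b
    · rw [Finset.sum_eq_single a]
      · simp [incidenceSingle_apply]
      · intro c _ hc
        simp [incidenceSingle_apply, hc]
      · simp [hab]
    · rw [Finset.Icc_eq_empty hab, Finset.sum_empty, f.apply_eq_zero_of_not_le hab]
  · exact Finset.sum_eq_zero fun c _ => by simp [incidenceSingle_apply, h]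

lemma mul_incidenceSingle_apply (s : T) (f : IncidenceAlgebra K T) (a b : T) :
    (f * incidenceSingle K (le_refl s)) a b = if b = s then f a s else 0 := by
  rw [IncidenceAlgebra.mul_apply]
  split_ifs with h
  · subst h
    by_cases hab : a ≤ b
    · rw [Finset.sum_eq_single b]
      · simp [incidenceSingle_apply]
      · intro c _ hc
        simp [incidenceSingle_apply, hc]
      · simp [hab]
    · rw [Finset.Icc_eq_empty hab, Finset.sum_empty, f.apply_eq_zero_of_not_le hab]
  · exact Finset.sum_eq_zero fun c _ => by simp [incidenceSingle_apply, h]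

lemma mem_peirce_incidenceSingle {s t : T} {f : IncidenceAlgebra K T} :
    f ∈ peirce K (incidenceSingle K (le_refl s)) (incidenceSingle K (le_refl t)) ↔
      ∀ a b, ¬ (a = s ∧ b = t) → f a b = 0 := by
  constructor
  · rintro ⟨h1, h2⟩ a b hab
    by_cases ha : a = s
    · have hb : b ≠ t := fun hb => hab ⟨ha, hb⟩
      rw [← h2, mul_incidenceSingle_apply, if_neg hb]
    · rw [← h1, incidenceSingle_mul_apply, if_neg ha]
  · intro h
    constructor
    · refine IncidenceAlgebra.ext fun a b _ => ?_
      rw [incidenceSingle_mul_apply]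
      split_ifs with ha
      · rw [ha]
      · rw [h a b fun h' => ha h'.1]
    · refine IncidenceAlgebra.ext fun a b _ => ?_
      rw [mul_incidenceSingle_apply]
      split_ifs with hb
      · rw [hb]
      · rw [h a b fun h' => hb h'.2]

lemma eq_smul_incidenceSingle {s t : T} (hst : s ≤ t) {f : IncidenceAlgebra K T}
    (hf : f ∈ peirce K (incidenceSingle K (le_refl s)) (incidenceSingle K (le_refl t))) :
    f = f s t • incidenceSingle K hst := by
  rw [mem_peirce_incidenceSingle] at hf
  refine IncidenceAlgebra.ext fun a b _ => ?_
  rw [IncidenceAlgebra.constSMul_apply, incidenceSingle_apply]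
  split_ifs with h
  · rw [h.1, h.2, smul_eq_mul, mul_one]
  · rw [hf a b h, smul_zero]

omit [LocallyFiniteOrder T] in
lemma incidenceSingle_ne_zero {s t : T} (hst : s ≤ t) : incidenceSingle K hst ≠ 0 := by
  intro h
  have := congrArg (fun f : IncidenceAlgebra K T => f s t) h
  simp [incidenceSingle_apply] at this

/-- The rank of `s` counts the elements strictly below it, so it increases strictly along the order.
-/
lemma isTriangularSystem_incidenceSingle [Fintype T] [DecidableLT T] :
    IsTriangularSystem K (fun s : T => incidenceSingle K (le_refl s))
      (fun s => (Finset.univ.filter (· < s)).card) where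
  idem s := IncidenceAlgebra.ext fun a b _ => by
    rw [incidenceSingle_mul_apply, incidenceSingle_apply, incidenceSingle_apply]
    by_cases h : a = s <;> simp [h]
  orthogonal s t hst := IncidenceAlgebra.ext fun a b _ => by
    rw [incidenceSingle_mul_apply, incidenceSingle_apply]
    simp [hst]
  sum_eq_one := IncidenceAlgebra.ext fun a b _ => by
    have h : ∀ (t : Finset T) (f : T → IncidenceAlgebra K T),
        (∑ s ∈ t, f s) a b = ∑ s ∈ t, f s a b := fun t f =>
      map_sum (⟨⟨fun f => f a b, rfl⟩, fun _ _ => rfl⟩ : IncidenceAlgebra K T →+ K) f t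
    rw [h, IncidenceAlgebra.one_apply, Finset.sum_eq_single a]
    · simp [incidenceSingle_apply, eq_comm]
    · intro c _ hc
      simp [incidenceSingle_apply, hc.symm]
    · simp
  ne_zero s := incidenceSingle_ne_zero K _
  scalar s f hf := ⟨_, eq_smul_incidenceSingle K _ hf⟩
  rank_lt s t hst f hf hf0 := by
    have h : s < t := by
      refine lt_of_le_of_ne ?_ hst
      by_contra hle
      refine hf0 (IncidenceAlgebra.ext fun a b hab => ?_)
      rw [(mem_peirce_incidenceSingle K).1 hf a b, IncidenceAlgebra.zero_apply]
      rintro ⟨rfl, rfl⟩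
      exact hle hab
    refine Finset.card_lt_card ((Finset.ssubset_iff_of_subset fun x hx => ?_).2 ⟨s, ?_, ?_⟩)
    · simp only [Finset.mem_filter, Finset.mem_univ, true_and] at hx ⊢
      exact hx.trans h
    · simpa using h
    · simp

/-- The matrix of the order relation of a poset. -/
def zetaMatrix (T : Type*) [PartialOrder T] [DecidableLE T] : Matrix T T ℚ :=
  Matrix.of fun s t => if s ≤ t then 1 else 0

lemma dimMatrix_incidenceSingle [DecidableLE T] :
    dimMatrix K (fun s : T => incidenceSingle K (le_refl s)) = zetaMatrix T := by
  ext s t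
  simp only [dimMatrix, zetaMatrix, Matrix.of_apply]
  split_ifs with hst
  · rw [finrank_eq_one (⟨incidenceSingle K hst, (mem_peirce_incidenceSingle K).2 fun a b h =>
      if_neg h⟩ : peirce K (incidenceSingle K (le_refl s)) (incidenceSingle K (le_refl t)))
      (fun h => incidenceSingle_ne_zero K hst (congrArg Subtype.val h)) fun f =>
      ⟨_, Subtype.ext (eq_smul_incidenceSingle K hst f.2).symm⟩, Nat.cast_one]
  · have : peirce K (incidenceSingle K (le_refl s)) (incidenceSingle K (le_refl t)) = ⊥ := by
      refine (Submodule.eq_bot_iff _).2 fun f hf => IncidenceAlgebra.ext fun a b hab => ?_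
      rw [(mem_peirce_incidenceSingle K).1 hf a b, IncidenceAlgebra.zero_apply]
      rintro ⟨rfl, rfl⟩
      exact hst hab
    rw [this, finrank_bot, Nat.cast_zero]

end Incidence

lemma posetCoxeterPolynomial_eq (K T : Type*) [Field K] [PartialOrder T] [Fintype T]
    [DecidableEq T] [DecidableLE T] :
    posetCoxeterPolynomial K T = pencilDet (zetaMatrix T) := by
  classical
  let _ : LocallyFiniteOrder T := Fintype.toLocallyFiniteOrder
  rw [← dimMatrix_incidenceSingle K,
    ← (isTriangularSystem_incidenceSingle K (T := T)).coxeterPolynomial_eq,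
    posetCoxeterPolynomial]
  -- Only decidability instances remain to be reconciled.
  congr!

/-! ### Deleting a vertex -/

section Corner

variable {K A : Type*} [Field K] [Ring A] [Algebra K A] {ι : Type*} [Fintype ι]
  {e : ι → A} {r : ι → ℕ}

lemma IsTriangularSystem.mem_corner_one_sub (h : IsTriangularSystem K e r) {v a : ι}
    (ha : a ≠ v) : e a ∈ Subsemigroup.corner (1 - e v) := by
  rw [Subsemigroup.mem_corner_iff (h.idem v).one_sub]
  rw [sub_mul, mul_sub, h.orthogonal _ _ ha, h.orthogonal _ _ ha.symm, one_mul, mul_one, sub_zero]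
  exact ⟨rfl, rfl⟩

/-- The idempotent `e a` for `a ≠ v` as an element of the corner ring at `1 - e v`. -/
def cornerIdempotent (h : IsTriangularSystem K e r) (v : ι) (a : {a : ι // a ≠ v}) :
    (h.idem v).one_sub.Corner :=
  ⟨e a, h.mem_corner_one_sub a.2⟩

lemma mem_peirce_cornerIdempotent (h : IsTriangularSystem K e r) {v : ι} {a b : {a : ι // a ≠ v}}
    {x : (h.idem v).one_sub.Corner} :
    x ∈ peirce K (cornerIdempotent h v a) (cornerIdempotent h v b) ↔
      x.1 ∈ peirce K (e a) (e b) :=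
  and_congr Subtype.ext_iff Subtype.ext_iff

variable [DecidableEq ι]

/-- Dropping `e v` leaves idempotents with sum `1 - e v`, which is the unit of the corner ring; the
other properties are inherited. -/
lemma isTriangularSystem_cornerIdempotent (h : IsTriangularSystem K e r) (v : ι) :
    IsTriangularSystem K (cornerIdempotent h v) fun a => r a where
  idem a := Subtype.ext (h.idem a)
  orthogonal a b hab := Subtype.ext (h.orthogonal a b fun h' => hab (Subtype.ext h'))
  sum_eq_one := by
    refine Subtype.ext ?_
    have h1 : (∑ a, cornerIdempotent h v a).1 = ∑ a : {a : ι // a ≠ v}, e a :=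
      map_sum (⟨⟨Subtype.val, rfl⟩, fun _ _ => rfl⟩ : (h.idem v).one_sub.Corner →+ A) _ _
    rw [h1]
    change _ = 1 - e v
    rw [← h.sum_eq_one, eq_sub_iff_add_eq, ← Fintype.sum_subtype_add_sum_subtype (· ≠ v) e]
    congr 1
    have : Unique {a : ι // ¬ a ≠ v} := ⟨⟨⟨v, by simp⟩⟩, fun a => Subtype.ext (not_not.1 a.2)⟩
    rw [Fintype.sum_unique, not_not.1 (default : {a : ι // ¬ a ≠ v}).2]
  ne_zero a h0 := h.ne_zero a (congrArg Subtype.val h0)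
  scalar a x hx := by
    obtain ⟨c, hc⟩ := h.scalar a x.1 ((mem_peirce_cornerIdempotent h).1 hx)
    exact ⟨c, Subtype.ext hc⟩
  rank_lt a b hab x hx hx0 := h.rank_lt a b (fun h' => hab (Subtype.ext h')) x.1
    ((mem_peirce_cornerIdempotent h).1 hx) fun h0 => hx0 (Subtype.ext h0)

omit [DecidableEq ι] in
-- For `a, b ≠ v` the idempotents `e a` and `e b` absorb `1 - e v`, so `e a A e b` already lies in
-- the corner.
lemma dimMatrix_cornerIdempotent (h : IsTriangularSystem K e r) (v : ι) :
    dimMatrix K (cornerIdempotent h v) = (dimMatrix K e).submatrix Subtype.val Subtype.val := by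
  ext a b
  simp only [dimMatrix, Matrix.of_apply, Matrix.submatrix_apply]
  congr 1
  refine LinearEquiv.finrank_eq
    { toFun := fun x => ⟨x.1.1, (mem_peirce_cornerIdempotent h).1 x.2⟩
      invFun := fun x => ⟨⟨x.1, ?_⟩, (mem_peirce_cornerIdempotent h).2 x.2⟩
      map_add' := fun _ _ => rfl
      map_smul' := fun _ _ => rfl
      left_inv := fun _ => rfl
      right_inv := fun _ => rfl }
  have ha := (Subsemigroup.mem_corner_iff (h.idem v).one_sub).1 (h.mem_corner_one_sub a.2)
  have hb := (Subsemigroup.mem_corner_iff (h.idem v).one_sub).1 (h.mem_corner_one_sub b.2)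
  exact (Subsemigroup.mem_corner_iff (h.idem v).one_sub).2
    ⟨by rw [← x.2.1, ← mul_assoc, ha.1], by rw [← x.2.2, mul_assoc, hb.2]⟩

end Corner

end Coxeter

/-! ### Homomorphisms out of a path algebra -/

namespace PathAlgebra

variable {K : Type k} {V : Type u} [Field K] [Quiver.{w} V] [Fintype V]

/-- The extension of a multiplicative function on paths to the path algebra. -/
noncomputable def liftHom {B : Type*} [Ring B] [Algebra K B] (f : ∀ {a b : V}, Path a b → B)
    (hcomp : ∀ {a b c : V} (p : Path a b) (q : Path b c), f (p.comp q) = f p * f q)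
    (hzero : ∀ {a b c d : V} (p : Path a b) (q : Path c d), c ≠ b → f p * f q = 0) :
    PathAlgebra K V →ₙₐ[K] B where
  toFun := lift fun p => f p.2.2
  map_smul' := map_smul _
  map_zero' := map_zero _
  map_add' := map_add _
  map_mul' x y := by
    induction x using PathAlgebra.induction with
    | zero => simp
    | add x x' hx hx' => simp only [add_mul, map_add, hx, hx']
    | smul c x hx => simp only [smul_mul_assoc, map_smul, hx]
    | path p =>
      rename_i a b
      induction y using PathAlgebra.induction with
      | zero => simp
      | add y y' hy hy' => simp only [mul_add, map_add, hy, hy']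
      | smul c y hy => simp only [mul_smul_comm, map_smul, hy]
      | path q =>
        rename_i c d
        by_cases h : c = b
        · subst h
          rw [ofPath_mul_comp, lift_ofPath, lift_ofPath, lift_ofPath, hcomp]
        · rw [ofPath_mul_of_ne _ _ h, map_zero, lift_ofPath, lift_ofPath, hzero p q h]

end PathAlgebra

namespace Triangular

open PathAlgebra Coxeter

/-! ### Vertex idempotents in quotients of path algebras -/

section Quotient

variable {K : Type k} {V : Type u} [Field K] [Fintype V] [Quiver.{w} V]
  (I : TwoSidedIdeal (PathAlgebra K V))

/-- The quotient map `KQ → KQ/I` as a linear map. -/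
noncomputable def mkLinear : PathAlgebra K V →ₗ[K] quotientAlgebra I where
  toFun := I.ringCon.mk'
  map_add' := map_add _
  map_smul' _ _ := rfl

lemma mkLinear_mul (x y : PathAlgebra K V) :
    mkLinear I (x * y) = mkLinear I x * mkLinear I y := map_mul I.ringCon.mk' x y

lemma mkLinear_eq_zero {x : PathAlgebra K V} : mkLinear I x = 0 ↔ x ∈ I := by
  rw [← TwoSidedIdeal.ker_ringCon_mk' I, TwoSidedIdeal.mem_ker, TwoSidedIdeal.ker_ringCon_mk']
  rfl

/-- The class of a path in `KQ/I`. -/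
noncomputable def pathClass {a b : V} (p : Path a b) : quotientAlgebra I := mkLinear I (ofPath K p)

lemma pathClass_comp {a b c : V} (p : Path a b) (q : Path b c) :
    pathClass I (p.comp q) = pathClass I p * pathClass I q := by
  rw [pathClass, ← ofPath_mul_comp, mkLinear_mul]
  rfl

lemma pathClass_mul_of_ne {a b c d : V} (p : Path a b) (q : Path c d) (h : c ≠ b) :
    pathClass I p * pathClass I q = 0 := by
  rw [pathClass, pathClass, ← mkLinear_mul, ofPath_mul_of_ne _ _ h, map_zero]

lemma pathClass_nil (a : V) : pathClass I (Path.nil : Path a a) = vertexIdempotent I a := rfl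

lemma pathClass_eq_iff {a b c d : V} (p : Path a b) (q : Path c d) :
    pathClass I p = pathClass I q ↔ ofPath K p - ofPath K q ∈ I := by
  rw [← mkLinear_eq_zero, map_sub, sub_eq_zero]
  rfl

lemma mkLinear_linearCombination {P : Type*} {a b : V} (f : P → Path a b) (c : P →₀ K) :
    mkLinear I (Finsupp.linearCombination K (fun p => ofPath K (f p)) c) =
      Finsupp.linearCombination K (fun p => pathClass I (f p)) c :=
  Finsupp.apply_linearCombination K (mkLinear I) _ c

lemma linearCombination_mem_iff {P : Type*} {a b : V} (f : P → Path a b) (c : P →₀ K) :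
    Finsupp.linearCombination K (fun p => ofPath K (f p)) c ∈ I ↔
      Finsupp.linearCombination K (fun p => pathClass I (f p)) c = 0 := by
  rw [← mkLinear_eq_zero, mkLinear_linearCombination]

/-- Multiplication by `e_a` on the left and `e_b` on the right fixes the paths from `a` to `b` and
kills all others. -/
lemma peirce_vertexIdempotent (a b : V) :
    peirce K (vertexIdempotent I a) (vertexIdempotent I b) =
      LinearMap.range (Finsupp.linearCombination K fun p : Path a b => pathClass I p) := by
  apply le_antisymm
  · rintro x ⟨hx, hx'⟩
    rw [← hx', ← hx]
    obtain ⟨z, rfl⟩ := RingCon.mk'_surjective (c := I.ringCon) x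
    change vertexIdempotent I a * mkLinear I z * _ ∈ _
    clear hx hx'
    induction z using PathAlgebra.induction with
    | zero => rw [map_zero, mul_zero, zero_mul]; exact Submodule.zero_mem _
    | add x y hx hy => rw [map_add, mul_add, add_mul]; exact Submodule.add_mem _ hx hy
    | smul c x hx =>
      rw [map_smul, mul_smul_comm, smul_mul_assoc]
      exact Submodule.smul_mem _ c hx
    | path p =>
      rename_i c d
      change vertexIdempotent I a * pathClass I p * _ ∈ _
      rw [← pathClass_nil, ← pathClass_nil]
      by_cases h : c = a
      · subst h
        rw [← pathClass_comp, Path.nil_comp]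
        by_cases h' : b = d
        · subst h'
          rw [← pathClass_comp, Path.comp_nil]
          exact ⟨Finsupp.single p 1, by rw [Finsupp.linearCombination_single, one_smul]⟩
        · rw [pathClass_mul_of_ne _ _ _ h']
          exact Submodule.zero_mem _
      · rw [pathClass_mul_of_ne _ _ _ h, zero_mul]
        exact Submodule.zero_mem _
  · rintro _ ⟨c, rfl⟩
    rw [Finsupp.linearCombination_apply]
    refine Submodule.sum_mem _ fun p _ => Submodule.smul_mem _ _ ⟨?_, ?_⟩
    · rw [← pathClass_nil, ← pathClass_comp, Path.nil_comp]
    · rw [← pathClass_nil, ← pathClass_comp, Path.comp_nil]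

open Classical in
/-- The rank of a vertex: the number of its predecessors. -/
noncomputable def vertexRank (a : V) : ℕ := (Finset.univ.filter fun c => Nonempty (Path c a)).card

omit [Fintype V] in
lemma eq_of_path_of_path (hac : ∀ (a : V) (p : Path a a), p = Path.nil) {a b : V} (p : Path a b)
    (q : Path b a) : a = b := by
  have h := congrArg Path.length (hac a (p.comp q))
  rw [Path.length_comp, Path.length_nil] at h
  exact Path.eq_of_length_zero p (by omega)

lemma vertexRank_lt (hac : ∀ (a : V) (p : Path a a), p = Path.nil) {a b : V} (hab : a ≠ b)
    (p : Path a b) : vertexRank a < vertexRank b := by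
  classical
  refine Finset.card_lt_card ((Finset.ssubset_iff_of_subset fun c hc => ?_).2 ⟨b, ?_, ?_⟩)
  · simp only [Finset.mem_filter, Finset.mem_univ, true_and] at hc ⊢
    exact ⟨hc.some.comp p⟩
  · simp only [Finset.mem_filter, Finset.mem_univ, true_and]
    exact ⟨Path.nil⟩
  · simp only [Finset.mem_filter, Finset.mem_univ, true_and]
    rintro ⟨q⟩
    exact hab (eq_of_path_of_path hac p q)

/-- In the quotient of the path algebra of an acyclic quiver by an ideal that does not contain
trivial paths, the idempotents of the vertices form a triangular system. -/
lemma isTriangularSystem_vertexIdempotent (hac : ∀ (a : V) (p : Path a a), p = Path.nil)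
    (hI : ∀ a, vertexIdempotent I a ≠ 0) :
    IsTriangularSystem K (vertexIdempotent I) vertexRank where
  idem := isIdempotentElem_vertexIdempotent I
  orthogonal a b hab := pathClass_mul_of_ne I (Path.nil : Path a a) (Path.nil : Path b b) hab.symm
  sum_eq_one := by
    rw [← map_one I.ringCon.mk', one_def, map_sum]
    rfl
  ne_zero := hI
  scalar a x hx := by
    rw [peirce_vertexIdempotent] at hx
    obtain ⟨c, rfl⟩ := hx
    refine ⟨c Path.nil, ?_⟩
    have : c = Finsupp.single Path.nil (c Path.nil) := by
      ext p
      rw [hac a p, Finsupp.single_eq_same]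
    conv_lhs => rw [this]
    rw [Finsupp.linearCombination_single, pathClass_nil]
  rank_lt a b hab x hx hx0 := by
    rw [peirce_vertexIdempotent] at hx
    obtain ⟨c, rfl⟩ := hx
    obtain ⟨p⟩ : Nonempty (Path a b) := by
      by_contra hemp
      rw [not_nonempty_iff] at hemp
      exact hx0 (by rw [Subsingleton.elim c 0, map_zero])
    exact vertexRank_lt hac hab p

open Classical in
/-- The homomorphism `KQ → K` which sends the trivial path at `v` to `1` and all other paths
to `0`. -/
noncomputable def augmentation (v : V) : PathAlgebra K V →ₙₐ[K] K :=
  liftHom (fun {a _} p => if p.length = 0 ∧ a = v then 1 else 0)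
    (fun {a b c} p q => by
      rw [Path.length_comp]
      by_cases hp : p.length = 0
      · obtain rfl := Path.eq_of_length_zero p hp
        by_cases ha : a = v <;> simp [hp, ha]
      · simp [hp])
    (fun {a b c d} p q h => by
      by_cases hp : p.length = 0
      · obtain rfl := Path.eq_of_length_zero p hp
        by_cases ha : a = v
        · subst ha
          simp [h]
        · simp [ha]
      · simp [hp])

open Classical in
lemma augmentation_ofPath (v : V) {a b : V} (p : Path a b) :
    augmentation v (ofPath K p) = if p.length = 0 ∧ a = v then 1 else 0 :=
  lift_ofPath _ p

variable {I}

/-- The augmentation at `v` kills the generators of `I`, which involve only paths of length at least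
`2`, but sends the trivial path at `v` to `1`. -/
lemma IsTriangular.vertexIdempotent_ne_zero (hI : IsTriangular I) (v : V) :
    vertexIdempotent I v ≠ 0 := by
  intro h
  have hv : ofPath K (Path.nil : Path v v) ∈ I := (mkLinear_eq_zero I).1 h
  obtain ⟨R, hR, rfl⟩ := hI.generated
  have hle : TwoSidedIdeal.span R ≤ TwoSidedIdeal.ker (augmentation (K := K) v) := by
    rw [TwoSidedIdeal.span_le]
    intro x hx
    obtain ⟨a, b, hab⟩ := hR x hx
    rw [SetLike.mem_coe, TwoSidedIdeal.mem_ker]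
    have h2 : Submodule.span K {x | ∃ p : Path a b, 2 ≤ p.length ∧ x = ofPath K p} ≤
        LinearMap.ker (augmentation (K := K) v : PathAlgebra K V →ₗ[K] K) := by
      rw [Submodule.span_le]
      rintro _ ⟨p, hp, rfl⟩
      refine (augmentation_ofPath v p).trans (if_neg ?_)
      rintro ⟨h0, -⟩
      omega
    exact h2 hab
  have h0 := (TwoSidedIdeal.mem_ker _).1 (hle hv)
  have h1 : augmentation (K := K) v (ofPath K (Path.nil : Path v v)) = 1 :=
    (augmentation_ofPath v _).trans (if_pos ⟨rfl, rfl⟩)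
  exact one_ne_zero (h1.symm.trans h0)

lemma IsTriangular.isTriangularSystem (hI : IsTriangular I) :
    IsTriangularSystem K (vertexIdempotent I) vertexRank :=
  isTriangularSystem_vertexIdempotent I hI.acyclic hI.vertexIdempotent_ne_zero

end Quotient

/-! ### Contracting the inserted poset to `v` -/

section Collapse

variable {V : Type u} [Quiver.{w} V] {v : V} {T : Type s} [PartialOrder T]

/-- The map from the vertices of `Q̃` to those of `Q` which sends the inserted poset to `v`. -/
def collapseVertex : InsertionVertex v T → V
  | Sum.inl a => a.1
  | Sum.inr _ => v

/-- The path of `Q` given by an arrow of `Q̃`; the arrows of the Hasse quiver become trivial. -/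
def collapseArrow : {x y : InsertionVertex v T} → (x ⟶ y) →
    Path (collapseVertex x) (collapseVertex y)
  | Sum.inl a, Sum.inl b, f => Hom.toPath (show a.1 ⟶ b.1 from f)
  | Sum.inl a, Sum.inr _, f => Hom.toPath (show a.1 ⟶ v from f.1)
  | Sum.inr _, Sum.inl b, f => Hom.toPath (show v ⟶ b.1 from f.1)
  | Sum.inr _, Sum.inr _, _ => Path.nil

/-- The path of `Q` given by a path of `Q̃`. -/
def collapse {x : InsertionVertex v T} : {y : InsertionVertex v T} → Path x y →
    Path (collapseVertex x) (collapseVertex y)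
  | _, Path.nil => Path.nil
  | _, Path.cons p f => (collapse p).comp (collapseArrow f)

lemma collapse_comp {x y z : InsertionVertex v T} (p : Path x y) (q : Path y z) :
    collapse (p.comp q) = (collapse p).comp (collapse q) := by
  induction q with
  | nil => rfl
  | cons q f ih => rw [Path.comp_cons, collapse, collapse, ih, Path.comp_assoc]

lemma collapse_mapPath {a b : Remaining v} (p : Path a b) :
    collapse ((toInsertion T).mapPath p) = toOriginal.mapPath p := by
  induction p with
  | nil => rfl
  | cons p f ih =>
    rw [Prefunctor.mapPath_cons, Prefunctor.mapPath_cons, collapse, ih]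
    rfl

lemma collapse_hassePath {s t : T} (q : @Path (Hasse T) _ s t) :
    collapse (hassePath (v := v) q) = Path.nil := by
  induction q with
  | nil => rfl
  | cons q f ih =>
    refine (congrArg (Path.comp · Path.nil) ih).trans ?_
    rfl

lemma collapse_modified_to {a : Remaining v} (p : PathTo a) {s : T} (hs : IsMin s) :
    collapse (PathTo.modified p hs) = PathTo.original p :=
  congrArg (Path.comp · (Hom.toPath (show p.1.1 ⟶ v from p.2.2))) (collapse_mapPath p.2.1)

lemma collapse_modified_from {b : Remaining v} (p : PathFrom b) {s : T} (hs : IsMax s) :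
    collapse (PathFrom.modified p hs) = PathFrom.original p := by
  refine (collapse_comp _ _).trans ?_
  exact congrArg (Path.comp (Hom.toPath (show v ⟶ p.1.1 from p.2.1))) (collapse_mapPath p.2.2)

lemma collapse_modified_between {a b : Remaining v} {s t : T} (hs : IsMin s) (ht : IsMax t)
    (q : @Path (Hasse T) _ s t) (p : PathBetween a b) :
    collapse (PathBetween.modified hs ht q p) = PathBetween.original p := by
  rcases p with p | ⟨p, p'⟩
  · exact collapse_mapPath p
  · refine (collapse_comp _ _).trans ?_
    rw [collapse_comp, collapse_modified_to, collapse_modified_from, collapse_hassePath]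
    rfl

lemma le_of_hassePath {s t : T} (q : @Path (Hasse T) _ s t) : s ≤ t := by
  induction q with
  | nil => exact le_refl s
  | cons q f ih => exact ih.trans f.down.le

lemma exists_hassePath [Finite T] {s t : T} (h : s ≤ t) : Nonempty (@Path (Hasse T) _ s t) := by
  classical
  have := Fintype.ofFinite T
  let _ : LocallyFiniteOrder T := Fintype.toLocallyFiniteOrder
  induction le_iff_reflTransGen_covBy.1 h with
  | refl => exact ⟨Path.nil⟩
  | tail h' hc ih =>
    obtain ⟨q⟩ := ih (le_iff_reflTransGen_covBy.2 h')
    exact ⟨Path.cons q (show @Quiver.Hom (Hasse T) _ _ _ from ⟨hc⟩)⟩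

lemma exists_hassePath_from_min [Finite T] (t : T) :
    ∃ s : T, IsMin s ∧ Nonempty (@Path (Hasse T) _ s t) := by
  obtain ⟨s, hst, hs⟩ := Finite.exists_le_minimal (p := fun _ : T => True) (a := t) trivial
  exact ⟨s, minimal_true.1 hs, exists_hassePath hst⟩

lemma exists_hassePath_to_max [Finite T] (s : T) :
    ∃ t : T, IsMax t ∧ Nonempty (@Path (Hasse T) _ s t) := by
  obtain ⟨t, hst, ht⟩ := Finite.exists_le_maximal (p := fun _ : T => True) (a := s) trivial
  exact ⟨t, maximal_true.1 ht, exists_hassePath hst⟩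

/-- Only Hasse arrows become trivial under the contraction, so a nontrivial path with trivial image
stays in the poset and climbs strictly. -/
lemma length_eq_zero_of_collapse {x y : InsertionVertex v T} (p : Path x y)
    (h : (collapse p).length = 0) :
    p.length = 0 ∨ ∃ s t : T, x = new v s ∧ y = new v t ∧ s < t := by
  induction p with
  | nil => exact Or.inl rfl
  | @cons y z p f ih =>
    rw [collapse, Path.length_comp] at h
    rcases y with a | s <;> rcases z with b | t
    · exact absurd h (Nat.succ_ne_zero _)
    · exact absurd h (Nat.succ_ne_zero _)
    · exact absurd h (Nat.succ_ne_zero _)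
    · right
      have hst : s < t := CovBy.lt f.down.down
      rcases ih (Nat.eq_zero_of_add_eq_zero_right h) with h0 | ⟨s', t', hx, hy, hlt⟩
      · exact ⟨s, t, Path.eq_of_length_zero p h0, rfl, hst⟩
      · obtain rfl : s = t' := Sum.inr_injective hy
        exact ⟨s', t, hx, rfl, hlt.trans hst⟩

/-- A closed path contracts to a closed path of `Q`, hence to a trivial one; if it were nontrivial
it would climb strictly from a poset element to itself. -/
lemma insertion_acyclic (hac : ∀ (a : V) (p : Path a a), p = Path.nil) (x : InsertionVertex v T)
    (p : Path x x) : p = Path.nil := by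
  rcases length_eq_zero_of_collapse p (by rw [hac _ (collapse p), Path.length_nil]) with
    h | ⟨s, t, hs, ht, hst⟩
  · exact Path.eq_nil_of_length_zero p h
  · exact absurd (Sum.inr_injective (hs.symm.trans ht)) hst.ne

end Collapse

/-! ### Decomposing the paths of `Q` at `v` -/

section Original

variable {V : Type u} [Quiver.{w} V] {v : V}

/-- The arrow would close an oriented cycle at `v`; this excludes a second visit to `v`. -/
lemma not_pathFrom_arrow (hac : ∀ (a : V) (p : Path a a), p = Path.nil) {b : Remaining v}
    (p : PathFrom b) (α : b.1 ⟶ v) : False := by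
  have h := congrArg Path.length (hac v ((PathFrom.original p).cons α))
  exact Nat.succ_ne_zero _ h

/-- Ensures that `PathBetween` and `PathTo` miss no path of `Q`. Both kinds of end point are treated
together because the induction passes through prefixes that may end at `v`. -/
lemma exists_original_of_ne (hac : ∀ (a : V) (p : Path a a), p = Path.nil) (a : Remaining v)
    {y : V} (p : Path a.1 y) :
    (∀ hy : y ≠ v, ∃ P : PathBetween a ⟨y, hy⟩, PathBetween.original P = p) ∧
      ∀ hy : y = v, ∃ P : PathTo a, PathTo.original P = p.cast rfl hy := by
  induction p with
  | nil => exact ⟨fun hy => ⟨Sum.inl Path.nil, rfl⟩, fun hy => absurd hy a.2⟩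
  | @cons y z p f ih =>
    by_cases hy : y = v
    · obtain ⟨P, hP⟩ := ih.2 hy
      subst hy
      refine ⟨fun hz => ⟨Sum.inr (P, ⟨⟨z, hz⟩, f, Path.nil⟩), ?_⟩, fun hz => ?_⟩
      · exact congrArg (Path.cons · f) hP
      · subst hz
        exact absurd (congrArg Path.length (hac _ f.toPath)) (Nat.succ_ne_zero _)
    · obtain ⟨P, hP⟩ := ih.1 hy
      refine ⟨fun hz => ?_, fun hz => ?_⟩
      · rcases P with P | ⟨P, c, β, P'⟩
        · refine ⟨Sum.inl (Path.cons (V := Remaining v) (b := (⟨y, hy⟩ : Remaining v)) P f), ?_⟩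
          exact congrArg (Path.cons · f) hP
        · exact ⟨Sum.inr (P, ⟨c, β,
            Path.cons (V := Remaining v) (b := (⟨y, hy⟩ : Remaining v)) P' f⟩),
            congrArg (Path.cons · f) hP⟩
      · subst hz
        rcases P with P | ⟨P, P'⟩
        · exact ⟨⟨⟨y, hy⟩, P, f⟩, congrArg (Path.cons · f) hP⟩
        · exact (not_pathFrom_arrow hac P' f).elim

lemma exists_original_from (hac : ∀ (a : V) (p : Path a a), p = Path.nil) {y : V}
    (p : Path v y) (hy : y ≠ v) : ∃ P : PathFrom (⟨y, hy⟩ : Remaining v),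
      PathFrom.original P = p := by
  induction p with
  | nil => exact absurd rfl hy
  | @cons y z p f ih =>
    by_cases h : y = v
    · subst h
      obtain rfl := hac _ p
      exact ⟨⟨⟨z, hy⟩, f, Path.nil⟩, rfl⟩
    · obtain ⟨⟨c, β, P⟩, hP⟩ := ih h
      exact ⟨⟨c, β, Path.cons (V := Remaining v) (b := (⟨y, h⟩ : Remaining v)) P f⟩,
        congrArg (Path.cons · f) hP⟩

end Original

/-! ### Lifting paths from `Q` to `Q̃` -/

section Lift

variable {V : Type u} [Quiver.{w} V] {v : V} {T : Type s} [PartialOrder T] [Finite T]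

/-- Every path of `Q` lifts to `Q̃`, for all choices of the end points over those of the path that
are compatible with the order of the inserted poset. -/
lemma exists_collapse_eq (hac : ∀ (a : V) (p : Path a a), p = Path.nil) [Nonempty T]
    (x y : InsertionVertex v T)
    (hxy : ∀ s t : T, x = new v s → y = new v t → s ≤ t)
    (p : Path (collapseVertex x) (collapseVertex y)) : ∃ P : Path x y, collapse P = p := by
  rcases x with a | s <;> rcases y with b | t
  · obtain ⟨P, hP⟩ := (exists_original_of_ne hac a p).1 b.2
    obtain ⟨s, hs, -⟩ := exists_hassePath_from_min (Classical.arbitrary T)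
    obtain ⟨t, ht, ⟨q⟩⟩ := exists_hassePath_to_max s
    exact ⟨PathBetween.modified hs ht q P, (collapse_modified_between hs ht q P).trans hP⟩
  · obtain ⟨P, hP⟩ := (exists_original_of_ne hac a p).2 rfl
    obtain ⟨s, hs, ⟨q⟩⟩ := exists_hassePath_from_min t
    refine ⟨(PathTo.modified P hs).comp (hassePath q), ?_⟩
    refine (collapse_comp _ _).trans ?_
    exact (congrArg₂ Path.comp (collapse_modified_to P hs) (collapse_hassePath q)).trans hP
  · obtain ⟨P, hP⟩ := exists_original_from hac p b.2
    obtain ⟨t, ht, ⟨q⟩⟩ := exists_hassePath_to_max s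
    refine ⟨(hassePath q).comp (PathFrom.modified P ht), ?_⟩
    refine (collapse_comp _ _).trans ?_
    refine (congrArg₂ Path.comp (collapse_hassePath q) (collapse_modified_from P ht)).trans ?_
    exact (Path.nil_comp _).trans hP
  · obtain ⟨q⟩ := exists_hassePath (hxy s t rfl rfl)
    exact ⟨hassePath q, (collapse_hassePath q).trans (hac v p).symm⟩

end Lift

/-! ### The contraction respects the relations -/

section Insertion

variable {K : Type k} {V : Type u} [Field K] [Fintype V] [Quiver.{w} V] {v : V}
  {T : Type s} [PartialOrder T] [Fintype T] (I : TwoSidedIdeal (PathAlgebra K V))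

open Classical in
/-- The homomorphism from `KQ̃` to matrices over `Λ` which sends a path of `Q̃` from `x` to `y` to
the class of the corresponding path of `Q` in position `(x, y)`. -/
noncomputable def collapseHom : PathAlgebra K (InsertionVertex v T) →ₙₐ[K]
    Matrix (InsertionVertex v T) (InsertionVertex v T) (quotientAlgebra I) :=
  liftHom (fun {x y} p => Matrix.single x y (pathClass I (collapse p)))
    (fun p q => by rw [collapse_comp, pathClass_comp, Matrix.single_mul_single_same])
    (fun p q h => Matrix.single_mul_single_of_ne _ _ _ _ h.symm _)

open Classical in
lemma collapseHom_ofPath {x y : InsertionVertex v T} (p : Path x y) :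
    collapseHom I (ofPath K p) = Matrix.single x y (pathClass I (collapse p)) :=
  lift_ofPath _ p

lemma collapseHom_linearCombination {P : Type*} {x y : InsertionVertex v T} (f : P → Path x y)
    (c : P →₀ K) :
    collapseHom I (Finsupp.linearCombination K (fun p => ofPath K (f p)) c) x y =
      Finsupp.linearCombination K (fun p => pathClass I (collapse (f p))) c := by
  classical
  induction c using Finsupp.induction_linear with
  | zero => simp
  | add c c' hc hc' => rw [map_add, map_add, map_add, Matrix.add_apply, hc, hc']
  | single p c =>
    rw [Finsupp.linearCombination_single, Finsupp.linearCombination_single, map_smul,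
      Matrix.smul_apply, collapseHom_ofPath, Matrix.single_apply_same]

lemma collapseHom_linearCombination_eq_zero {P : Type*} {x y : InsertionVertex v T}
    (f : P → Path x y) (c : P →₀ K)
    (h : Finsupp.linearCombination K (fun p => pathClass I (collapse (f p))) c = 0) :
    collapseHom I (Finsupp.linearCombination K (fun p => ofPath K (f p)) c) = 0 := by
  classical
  have key : ∀ c : P →₀ K,
      collapseHom I (Finsupp.linearCombination K (fun p => ofPath K (f p)) c) =
        Matrix.single x y
          (Finsupp.linearCombination K (fun p => pathClass I (collapse (f p))) c) := by
    intro c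
    induction c using Finsupp.induction_linear with
    | zero => simp
    | add c c' hc hc' => rw [map_add, map_add, map_add, Matrix.single_add, hc, hc']
    | single p c =>
      rw [Finsupp.linearCombination_single, Finsupp.linearCombination_single, map_smul,
        collapseHom_ofPath, Matrix.smul_single]
  rw [key, h, Matrix.single_zero]

lemma collapseHom_sub_eq_zero {x y : InsertionVertex v T} (p q : Path x y)
    (h : collapse p = collapse q) : collapseHom I (ofPath K p - ofPath K q) = 0 := by
  classical
  rw [map_sub, collapseHom_ofPath, collapseHom_ofPath, h, sub_self]

/-- Relations built from a combination in `I` contract to that combination, and the two terms of a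
commutation relation contract to the same path. -/
lemma collapseHom_eq_zero_of_relation {x : PathAlgebra K (InsertionVertex v T)}
    (hx : InsertionRelation T I v x) : collapseHom I x = 0 := by
  cases hx with
  | ending c hc hs =>
    refine collapseHom_linearCombination_eq_zero I _ c ?_
    simp only [collapse_modified_to]
    exact (linearCombination_mem_iff I _ c).1 hc
  | starting c hc hs =>
    refine collapseHom_linearCombination_eq_zero I _ c ?_
    simp only [collapse_modified_from]
    exact (linearCombination_mem_iff I _ c).1 hc
  | commute q q' =>
    exact collapseHom_sub_eq_zero I _ _ (by rw [collapse_hassePath, collapse_hassePath])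
  | commute_in α hs hs' q q' =>
    refine collapseHom_sub_eq_zero I _ _ ?_
    rw [collapse_comp, collapse_comp, collapse_hassePath, collapse_hassePath]
    rfl
  | commute_out β ht ht' q q' =>
    refine collapseHom_sub_eq_zero I _ _ ?_
    rw [collapse, collapse, collapse_hassePath, collapse_hassePath]
    rfl
  | commute_through α β hs hs' ht ht' q q' =>
    refine collapseHom_sub_eq_zero I _ _ ?_
    rw [collapse, collapse, collapse_comp, collapse_comp, collapse_hassePath, collapse_hassePath]
    rfl
  | through c hc hs ht q =>
    refine collapseHom_linearCombination_eq_zero I _ c ?_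
    simp only [collapse_modified_between]
    exact (linearCombination_mem_iff I _ c).1 hc

variable (v T) in
/-- The ideal `Ĩ` of the insertion. -/
noncomputable abbrev insertionIdeal : TwoSidedIdeal (PathAlgebra K (InsertionVertex v T)) :=
  TwoSidedIdeal.span {x | InsertionRelation T I v x}

lemma collapseHom_eq_zero {x : PathAlgebra K (InsertionVertex v T)}
    (hx : x ∈ insertionIdeal v T I) : collapseHom I x = 0 := by
  have h : insertionIdeal v T I ≤ TwoSidedIdeal.ker (collapseHom I) := by
    rw [TwoSidedIdeal.span_le]
    intro x hx
    exact (TwoSidedIdeal.mem_ker _).2 (collapseHom_eq_zero_of_relation I hx)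
  exact (TwoSidedIdeal.mem_ker _).1 (h hx)

/-- The trivial path at `x` is sent to a nonzero vertex idempotent of `Λ` in position `(x, x)`. -/
lemma insertion_vertexIdempotent_ne_zero (h : ∀ a, vertexIdempotent I a ≠ 0)
    (x : InsertionVertex v T) : vertexIdempotent (insertionIdeal v T I) x ≠ 0 := by
  classical
  intro h0
  have h1 := collapseHom_eq_zero I ((mkLinear_eq_zero (insertionIdeal v T I)).1 h0)
  rw [collapseHom_ofPath] at h1
  have h2 := congrFun (congrFun h1 x) x
  rw [Matrix.single_apply_same] at h2
  exact h _ h2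

end Insertion

/-! ### Normal forms of paths modulo `Ĩ` -/

section NormalForm

variable {K : Type k} {V : Type u} [Field K] [Fintype V] [Quiver.{w} V] {v : V}
  {T : Type s} [PartialOrder T] [Fintype T] {I : TwoSidedIdeal (PathAlgebra K V)}

variable (I) in
/-- The class of a path of `Q̃` in the insertion. -/
noncomputable abbrev insertionClass {x y : InsertionVertex v T} (p : Path x y) :
    insertion T I v :=
  pathClass (insertionIdeal v T I) p

lemma insertionClass_eq_of_relation {x y x' y' : InsertionVertex v T} {p : Path x y}
    {q : Path x' y'} (h : InsertionRelation T I v (ofPath K p - ofPath K q)) :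
    insertionClass I p = insertionClass I q :=
  (pathClass_eq_iff _ p q).2 (TwoSidedIdeal.subset_span h)

lemma insertionClass_comp {x y z : InsertionVertex v T} (p : Path x y) (q : Path y z) :
    insertionClass I (p.comp q) = insertionClass I p * insertionClass I q :=
  pathClass_comp _ p q

lemma insertionClass_modified_to {a : Remaining v} (P : PathTo a) {m : T} (hm : IsMin m) :
    insertionClass I (PathTo.modified P hm) =
      insertionClass I ((toInsertion T).mapPath P.2.1) *
        insertionClass I (arrowIn P.2.2 hm).toPath :=
  insertionClass_comp ((toInsertion T).mapPath P.2.1) (arrowIn P.2.2 hm).toPath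

lemma insertionClass_modified_between {a b : Remaining v} {m n : T} (hm : IsMin m)
    (hn : IsMax n) (q : @Path (Hasse T) _ m n) (P : PathTo a) (P' : PathFrom b) :
    insertionClass I (PathBetween.modified hm hn q (Sum.inr (P, P'))) =
      insertionClass I (PathTo.modified P hm) * insertionClass I (hassePath q) *
        insertionClass I (PathFrom.modified P' hn) := by
  rw [← insertionClass_comp, ← insertionClass_comp]
  rfl

lemma insertionClass_hassePath {s t : T} (q q' : @Path (Hasse T) _ s t) :
    insertionClass (v := v) I (hassePath q) = insertionClass I (hassePath q') :=
  insertionClass_eq_of_relation (.commute q q')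

lemma insertionClass_in {a : Remaining v} (α : a.1 ⟶ v) {m m' t : T} (hm : IsMin m)
    (hm' : IsMin m') (q : @Path (Hasse T) _ m t) (q' : @Path (Hasse T) _ m' t) :
    insertionClass I (arrowIn α hm).toPath * insertionClass I (hassePath q) =
      insertionClass I (arrowIn α hm').toPath * insertionClass I (hassePath q') := by
  rw [← insertionClass_comp, ← insertionClass_comp]
  exact insertionClass_eq_of_relation (.commute_in α hm hm' q q')

lemma insertionClass_out {b : Remaining v} (β : v ⟶ b.1) {s n n' : T} (hn : IsMax n)
    (hn' : IsMax n') (q : @Path (Hasse T) _ s n) (q' : @Path (Hasse T) _ s n') :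
    insertionClass I (hassePath q) * insertionClass I (arrowOut hn β).toPath =
      insertionClass I (hassePath q') * insertionClass I (arrowOut hn' β).toPath := by
  rw [← insertionClass_comp, ← insertionClass_comp]
  exact insertionClass_eq_of_relation (.commute_out β hn hn' q q')

lemma insertionClass_through {a b : Remaining v} (α : a.1 ⟶ v) (β : v ⟶ b.1) {m m' n n' : T}
    (hm : IsMin m) (hm' : IsMin m') (hn : IsMax n) (hn' : IsMax n')
    (q : @Path (Hasse T) _ m n) (q' : @Path (Hasse T) _ m' n') :
    insertionClass I (arrowIn α hm).toPath * insertionClass I (hassePath q) *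
        insertionClass I (arrowOut hn β).toPath =
      insertionClass I (arrowIn α hm').toPath * insertionClass I (hassePath q') *
        insertionClass I (arrowOut hn' β).toPath := by
  rw [← insertionClass_comp, ← insertionClass_comp, ← insertionClass_comp, ← insertionClass_comp]
  exact insertionClass_eq_of_relation (.commute_through α β hm hm' hn hn' q q')

lemma insertionClass_modified_to_comp {a : Remaining v} (P : PathTo a) {m m' t : T}
    (hm : IsMin m) (hm' : IsMin m') (q : @Path (Hasse T) _ m t) (q' : @Path (Hasse T) _ m' t) :
    insertionClass I ((PathTo.modified P hm).comp (hassePath q)) =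
      insertionClass I ((PathTo.modified P hm').comp (hassePath q')) := by
  rw [insertionClass_comp, insertionClass_comp, insertionClass_modified_to,
    insertionClass_modified_to, mul_assoc, mul_assoc, insertionClass_in P.2.2 hm hm' q q']

lemma insertionClass_cons {x y z x' : InsertionVertex v T} {p : Path x y} {p' : Path x' y}
    (f : y ⟶ z) (h : insertionClass I p = insertionClass I p') :
    insertionClass I (p.cons f) = insertionClass I (p'.cons f) := by
  refine (insertionClass_comp p f.toPath).trans ?_
  exact (congrArg (· * insertionClass I f.toPath) h).trans (insertionClass_comp p' f.toPath).symm

/-- The normal forms of the paths of `Q̃` which start at a vertex of `Q`. -/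
lemma exists_normalForm_old (hac : ∀ (a : V) (p : Path a a), p = Path.nil) {a : Remaining v}
    {y : InsertionVertex v T} (p : Path (old T a) y) :
    (∀ b, y = old T b → ∃ P : PathBetween a b, ∀ {m n : T} (hm : IsMin m) (hn : IsMax n)
      (q : @Path (Hasse T) _ m n),
      insertionClass I p = insertionClass I (PathBetween.modified hm hn q P)) ∧
    ∀ t, y = new v t → ∃ P : PathTo a, ∀ {m : T} (hm : IsMin m) (q : @Path (Hasse T) _ m t),
      insertionClass I p = insertionClass I ((PathTo.modified P hm).comp (hassePath q)) := by
  induction p with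
  | nil =>
    refine ⟨fun b hb => ?_, fun t ht => (Sum.inl_ne_inr ht).elim⟩
    obtain rfl : a = b := Sum.inl_injective hb
    exact ⟨Sum.inl Path.nil, fun _ _ _ => rfl⟩
  | @cons y z p f ih =>
    constructor
    · rintro b rfl
      rcases y with c | s
      · obtain ⟨P, hP⟩ := ih.1 c rfl
        rcases P with P | ⟨P, d, β, P'⟩
        · exact ⟨Sum.inl (Path.cons (V := Remaining v) P f),
            fun hm hn q => insertionClass_cons f (hP hm hn q)⟩
        · exact ⟨Sum.inr (P, ⟨d, β, Path.cons (V := Remaining v) P' f⟩),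
            fun hm hn q => insertionClass_cons f (hP hm hn q)⟩
      · obtain ⟨P, hP⟩ := ih.2 s rfl
        obtain ⟨m, hm, ⟨q⟩⟩ := exists_hassePath_from_min s
        refine ⟨Sum.inr (P, ⟨b, f.1, Path.nil⟩), fun hm' hn' q' => ?_⟩
        refine (insertionClass_cons f (hP hm q)).trans ?_
        have h1 : insertionClass I
            (Path.cons (c := old T b) ((PathTo.modified P hm).comp (hassePath q)) f) =
            insertionClass I (PathTo.modified P hm) * insertionClass I (hassePath q) *
              insertionClass I (arrowOut f.2 f.1 : new v s ⟶ old T b).toPath := by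
          rw [← insertionClass_comp, ← insertionClass_comp]
          rfl
        have h2 : insertionClass I (PathFrom.modified (S := T) (v := v) (b := b)
            ⟨b, f.1, Path.nil⟩ hn') = insertionClass I (arrowOut hn' f.1).toPath := rfl
        refine h1.trans ?_
        rw [insertionClass_modified_between, insertionClass_modified_to,
          insertionClass_modified_to, h2]
        -- Both ends of the poset path are exchanged at once: `m` and `m'` may be different minimal
        -- elements, and `s` and `n'` different maximal ones.
        have h3 := insertionClass_through (I := I) P.2.2 f.1 hm hm' f.2 hn' q q'
        simp only [mul_assoc] at h3 ⊢
        rw [h3]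
    · rintro t rfl
      rcases y with c | s
      · obtain ⟨P, hP⟩ := ih.1 c rfl
        rcases P with P | ⟨P, P'⟩
        · refine ⟨⟨c, P, f.1⟩, fun hm q => ?_⟩
          -- The induction hypothesis asks for a path from a minimal to a maximal element, although
          -- `P` does not use it. Since `f` ends at `t`, the element `t` is minimal and can serve as
          -- its start.
          obtain ⟨n, hn, ⟨q'⟩⟩ := exists_hassePath_to_max t
          refine (insertionClass_cons f (hP f.2 hn q')).trans ?_
          refine Eq.trans ?_ (insertionClass_modified_to_comp ⟨c, P, f.1⟩ f.2 hm Path.nil q)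
          rfl
        · exact (not_pathFrom_arrow hac P' f.1).elim
      · obtain ⟨P, hP⟩ := ih.2 s rfl
        obtain ⟨m', hm', ⟨q'⟩⟩ := exists_hassePath_from_min s
        refine ⟨P, fun hm q => ?_⟩
        refine (insertionClass_cons f (hP hm' q')).trans ?_
        exact insertionClass_modified_to_comp P hm' hm (Path.cons (V := Hasse T) q' f.down) q

/-- The normal forms of the paths of `Q̃` which start at a vertex of the inserted poset. -/
lemma exists_normalForm_new (hac : ∀ (a : V) (p : Path a a), p = Path.nil) {s : T}
    {y : InsertionVertex v T} (p : Path (new v s) y) :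
    (∀ b, y = old T b → ∃ P : PathFrom b, ∀ {n : T} (hn : IsMax n)
      (q : @Path (Hasse T) _ s n),
      insertionClass I p = insertionClass I ((hassePath q).comp (PathFrom.modified P hn))) ∧
    ∀ t, y = new v t → ∃ q : @Path (Hasse T) _ s t,
      insertionClass I p = insertionClass I (hassePath q) := by
  induction p with
  | nil =>
    refine ⟨fun b hb => (Sum.inr_ne_inl hb).elim, fun t ht => ?_⟩
    obtain rfl : s = t := Sum.inr_injective ht
    exact ⟨Path.nil, rfl⟩
  | @cons y z p f ih =>
    constructor
    · rintro b rfl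
      rcases y with c | t
      · obtain ⟨⟨d, β, P⟩, hP⟩ := ih.1 c rfl
        exact ⟨⟨d, β, Path.cons (V := Remaining v) P f⟩,
          fun hn q => insertionClass_cons f (hP hn q)⟩
      · obtain ⟨q, hq⟩ := ih.2 t rfl
        refine ⟨⟨b, f.1, Path.nil⟩, fun hn' q' => ?_⟩
        refine (insertionClass_cons f hq).trans ?_
        refine (insertionClass_comp (hassePath q)
          (arrowOut f.2 f.1 : new v t ⟶ old T b).toPath).trans ?_
        refine (insertionClass_out f.1 f.2 hn' q q').trans ?_
        exact (insertionClass_comp (hassePath q') (arrowOut hn' f.1).toPath).symm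
    · rintro t rfl
      rcases y with c | t'
      · obtain ⟨P, -⟩ := ih.1 c rfl
        exact (not_pathFrom_arrow hac P f.1).elim
      · obtain ⟨q, hq⟩ := ih.2 t' rfl
        exact ⟨Path.cons (V := Hasse T) q f.down, insertionClass_cons f hq⟩

end NormalForm

/-! ### Dimensions of the Peirce components of the insertion -/

section Dimensions

variable {K : Type k} {V : Type u} [Field K] [Fintype V] [Quiver.{w} V] {v : V}
  {T : Type s} [PartialOrder T] [Fintype T] {I : TwoSidedIdeal (PathAlgebra K V)}

/-- One half of the comparison: `collapseHom` vanishes on `Ĩ`, and its entry at `(x, y)` is the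
contracted combination in `Λ`. -/
lemma linearCombination_collapse_eq_zero {x y : InsertionVertex v T} (c : Path x y →₀ K)
    (h : Finsupp.linearCombination K (fun p : Path x y => insertionClass I p) c = 0) :
    Finsupp.linearCombination K (fun p : Path x y => pathClass I (collapse p)) c = 0 := by
  rw [← collapseHom_linearCombination I (fun p => p) c,
    collapseHom_eq_zero I ((linearCombination_mem_iff _ (fun p : Path x y => p) c).2 h)]
  rfl

lemma pathClass_collapse_eq {x y : InsertionVertex v T} {p q : Path x y}
    (h : insertionClass I p = insertionClass I q) :
    pathClass I (collapse p) = pathClass I (collapse q) := by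
  have h1 := linearCombination_collapse_eq_zero (I := I)
    (Finsupp.single p 1 - Finsupp.single q 1) (by
      rw [map_sub, Finsupp.linearCombination_single, Finsupp.linearCombination_single, h, sub_self])
  rwa [map_sub, Finsupp.linearCombination_single, Finsupp.linearCombination_single, one_smul,
    one_smul, sub_eq_zero] at h1

/-- If the paths `p` of `Q̃` from `x` to `y` have normal forms `g (N p)`, it suffices to check
on normal forms that a combination vanishes in the insertion. -/
lemma linearCombination_eq_zero_of_normalForm {x y : InsertionVertex v T} {P : Type*} {a b : V}
    (g : P → Path x y) (g' : P → Path a b)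
    (hg : ∀ p, pathClass I (collapse (g p)) = pathClass I (g' p))
    (hrel : ∀ c : P →₀ K, Finsupp.linearCombination K (fun p => ofPath K (g' p)) c ∈ I →
      Finsupp.linearCombination K (fun p => insertionClass I (g p)) c = 0)
    (hN : ∀ p : Path x y, ∃ n, insertionClass I p = insertionClass I (g n)) (c : Path x y →₀ K)
    (h : Finsupp.linearCombination K (fun p : Path x y => pathClass I (collapse p)) c = 0) :
    Finsupp.linearCombination K (fun p : Path x y => insertionClass I p) c = 0 := by
  choose N hN using hN
  have h1 : (fun p : Path x y => insertionClass I p) = (fun n => insertionClass I (g n)) ∘ N :=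
    funext hN
  have h2 : (fun p : Path x y => pathClass I (collapse p)) = (fun n => pathClass I (g' n)) ∘ N :=
    funext fun p => (pathClass_collapse_eq (hN p)).trans (hg _)
  -- Pushing `c` forward along `N` replaces it by a combination of normal forms.
  rw [h2, ← Finsupp.linearCombination_mapDomain] at h
  rw [h1, ← Finsupp.linearCombination_mapDomain]
  exact hrel _ ((linearCombination_mem_iff I g' _).2 h)

lemma linearCombination_mul_right {P : Type*} {x y z : InsertionVertex v T} (g : P → Path x y)
    (q : Path y z) (c : P →₀ K) :
    Finsupp.linearCombination K (fun p => insertionClass I ((g p).comp q)) c =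
      Finsupp.linearCombination K (fun p => insertionClass I (g p)) c * insertionClass I q := by
  simp only [insertionClass_comp]
  exact (Finsupp.apply_linearCombination K (LinearMap.mulRight K (insertionClass I q)) _ c).symm

lemma linearCombination_mul_left {P : Type*} {x y z : InsertionVertex v T} (g : P → Path y z)
    (q : Path x y) (c : P →₀ K) :
    Finsupp.linearCombination K (fun p => insertionClass I (q.comp (g p))) c =
      insertionClass I q * Finsupp.linearCombination K (fun p => insertionClass I (g p)) c := by
  simp only [insertionClass_comp]
  exact (Finsupp.apply_linearCombination K (LinearMap.mulLeft K (insertionClass I q)) _ c).symm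

lemma linearCombination_insertionClass_eq_zero {P : Type*} {x y : InsertionVertex v T}
    (g : P → Path x y) (c : P →₀ K)
    (h : InsertionRelation T I v (Finsupp.linearCombination K (fun p => ofPath K (g p)) c)) :
    Finsupp.linearCombination K (fun p => insertionClass I (g p)) c = 0 :=
  (linearCombination_mem_iff _ g c).1 (TwoSidedIdeal.subset_span h)

/-- The other half of the comparison. In normal form, a relation in `Λ` is an element of `I` that
the generators `through`, `ending` and `starting` transfer to `Ĩ`, possibly after multiplication by
a poset path. Between two poset elements there is at most one class of paths. -/
lemma linearCombination_insertion_eq_zero (hI : IsTriangular I) [Nonempty T]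
    {x y : InsertionVertex v T} (c : Path x y →₀ K)
    (h : Finsupp.linearCombination K (fun p : Path x y => pathClass I (collapse p)) c = 0) :
    Finsupp.linearCombination K (fun p : Path x y => insertionClass I p) c = 0 := by
  have hac := hI.acyclic
  rcases x with a | s <;> rcases y with b | t
  · obtain ⟨m, hm, -⟩ := exists_hassePath_from_min (Classical.arbitrary T)
    obtain ⟨n, hn, ⟨q⟩⟩ := exists_hassePath_to_max m
    refine linearCombination_eq_zero_of_normalForm
      (fun P : PathBetween a b => PathBetween.modified hm hn q P) PathBetween.original
      (fun P => congrArg (pathClass I) (collapse_modified_between hm hn q P)) (fun c hc => ?_)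
      (fun p => ?_) c h
    · exact linearCombination_insertionClass_eq_zero (I := I) _ c (.through c hc hm hn q)
    · obtain ⟨P, hP⟩ := (exists_normalForm_old (I := I) hac p).1 b rfl
      exact ⟨P, hP hm hn q⟩
  · obtain ⟨m, hm, ⟨q⟩⟩ := exists_hassePath_from_min t
    refine linearCombination_eq_zero_of_normalForm
      (fun P : PathTo a => (PathTo.modified P hm).comp (hassePath q)) PathTo.original
      (fun P => congrArg (pathClass I) ?_) (fun c hc => ?_) (fun p => ?_) c h
    · refine (collapse_comp _ _).trans ?_
      exact congrArg₂ Path.comp (collapse_modified_to P hm) (collapse_hassePath q)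
    · refine (linearCombination_mul_right _ _ c).trans ?_
      rw [linearCombination_insertionClass_eq_zero _ c (.ending c hc hm), zero_mul]
    · obtain ⟨P, hP⟩ := (exists_normalForm_old (I := I) hac p).2 t rfl
      exact ⟨P, hP hm q⟩
  · obtain ⟨n, hn, ⟨q⟩⟩ := exists_hassePath_to_max s
    refine linearCombination_eq_zero_of_normalForm
      (fun P : PathFrom b => (hassePath q).comp (PathFrom.modified P hn)) PathFrom.original
      (fun P => congrArg (pathClass I) ?_) (fun c hc => ?_) (fun p => ?_) c h
    · refine (collapse_comp _ _).trans ?_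
      refine (congrArg₂ Path.comp (collapse_hassePath q) (collapse_modified_from P hn)).trans ?_
      exact Path.nil_comp _
    · refine (linearCombination_mul_left _ _ c).trans ?_
      rw [linearCombination_insertionClass_eq_zero _ c (.starting c hc hn), mul_zero]
    · obtain ⟨P, hP⟩ := (exists_normalForm_new (I := I) hac p).1 b rfl
      exact ⟨P, hP hn q⟩
  · by_cases hst : s ≤ t
    · obtain ⟨q⟩ := exists_hassePath hst
      refine linearCombination_eq_zero_of_normalForm
        (fun _ : Unit => hassePath q) (fun _ => (Path.nil : Path v v))
        (fun P => congrArg (pathClass I) (collapse_hassePath q)) (fun c hc => ?_) (fun p => ?_) c h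
      -- The single coefficient multiplies `e_v`, which is nonzero in `Λ`, so it vanishes.
      · have h1 := (linearCombination_mem_iff I (fun _ : Unit => (Path.nil : Path v v)) c).1 hc
        rw [Finsupp.linearCombination_unique] at h1
        have h2 := (smul_eq_zero.1 h1).resolve_right (hI.vertexIdempotent_ne_zero v)
        rw [Finsupp.linearCombination_unique, h2, zero_smul]
      · obtain ⟨q', hq'⟩ := (exists_normalForm_new (I := I) hac p).2 t rfl
        exact ⟨(), hq'.trans (insertionClass_hassePath q' q)⟩
    · have : IsEmpty (Path (new v s) (new v t)) := ⟨fun p => hst <| by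
        obtain ⟨q', -⟩ := (exists_normalForm_new (I := I) hac p).2 t rfl
        exact le_of_hassePath q'⟩
      have hc : c = 0 := Finsupp.ext fun p => (this.false p).elim
      rw [hc, map_zero]

/-- The Peirce components of the insertion are isomorphic to those of `Λ`. -/
lemma finrank_peirce_insertion (hI : IsTriangular I) [Nonempty T] (x y : InsertionVertex v T)
    (hxy : ∀ s t : T, x = new v s → y = new v t → s ≤ t) :
    Module.finrank K (peirce K (vertexIdempotent (insertionIdeal v T I) x)
        (vertexIdempotent (insertionIdeal v T I) y)) =
      Module.finrank K (peirce K (vertexIdempotent I (collapseVertex x))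
        (vertexIdempotent I (collapseVertex y))) := by
  rw [peirce_vertexIdempotent, peirce_vertexIdempotent]
  set F := Finsupp.linearCombination K fun p : Path x y => insertionClass I p
  set G := Finsupp.linearCombination K fun p : Path x y => pathClass I (collapse p) with hG
  -- `F` and `G` are defined on the same space of combinations of paths, so equal kernels make their
  -- ranges isomorphic.
  have hker : LinearMap.ker F = LinearMap.ker G := by
    ext c
    exact ⟨linearCombination_collapse_eq_zero c, linearCombination_insertion_eq_zero hI c⟩
  have hrange : LinearMap.range G = LinearMap.range (Finsupp.linearCombination K
      fun p : Path (collapseVertex x) (collapseVertex y) => pathClass I p) := by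
    rw [hG, Finsupp.range_linearCombination, Finsupp.range_linearCombination]
    congr 1
    ext z
    constructor
    · rintro ⟨p, rfl⟩
      exact ⟨collapse p, rfl⟩
    · rintro ⟨p, rfl⟩
      obtain ⟨P, rfl⟩ := exists_collapse_eq hI.acyclic x y hxy p
      exact ⟨P, rfl⟩
  rw [← hrange]
  exact ((F.quotKerEquivRange.symm.trans (Submodule.quotEquivOfEq _ _ hker)).trans
    G.quotKerEquivRange).finrank_eq

lemma finrank_peirce_insertion_of_not_le (hI : IsTriangular I) {s t : T} (hst : ¬ s ≤ t) :
    Module.finrank K (peirce K (vertexIdempotent (insertionIdeal v T I) (new v s))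
        (vertexIdempotent (insertionIdeal v T I) (new v t))) = 0 := by
  have : IsEmpty (Path (new v s) (new v t)) := ⟨fun p => hst <| by
    obtain ⟨q', -⟩ := (exists_normalForm_new (I := I) hI.acyclic p).2 t rfl
    exact le_of_hassePath q'⟩
  rw [peirce_vertexIdempotent, Finsupp.range_linearCombination, Set.range_eq_empty,
    Submodule.span_empty, finrank_bot]

lemma IsTriangular.isTriangularSystem_insertion (hI : IsTriangular I) :
    IsTriangularSystem K (vertexIdempotent (insertionIdeal v T I)) vertexRank :=
  isTriangularSystem_vertexIdempotent _ (insertion_acyclic hI.acyclic)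
    (insertion_vertexIdempotent_ne_zero I hI.vertexIdempotent_ne_zero)

end Dimensions

/-! ### The dimension matrices in bordered form -/

section Matrices

variable {K : Type k} {V : Type u} [Field K] [Fintype V] [Quiver.{w} V] {v : V}
  {S : Type s} [PartialOrder S] [Fintype S] {I : TwoSidedIdeal (PathAlgebra K V)}

/-- The vertices of the insertion of `S ∪ {⊤}`, with `⊤` as the last index. -/
def insertionVertexEquiv (v : V) (S : Type s) :
    ({a : V // a ≠ v} ⊕ S) ⊕ Unit ≃ InsertionVertex v (WithTop S) where
  toFun
    | Sum.inl (Sum.inl a) => Sum.inl a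
    | Sum.inl (Sum.inr s) => Sum.inr (s : WithTop S)
    | Sum.inr () => Sum.inr ⊤
  invFun
    | Sum.inl a => Sum.inl (Sum.inl a)
    | Sum.inr (some s) => Sum.inl (Sum.inr s)
    | Sum.inr none => Sum.inr ()
  left_inv := by rintro ((a | s) | ⟨⟩) <;> rfl
  right_inv := by rintro (a | (_ | s)) <;> rfl

/-- The elements of `S ∪ {⊤}`, with `⊤` as the last index. -/
def withTopEquiv (S : Type s) : S ⊕ Unit ≃ WithTop S where
  toFun
    | Sum.inl s => (s : WithTop S)
    | Sum.inr () => ⊤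
  invFun
    | some s => Sum.inl s
    | none => Sum.inr ()
  left_inv := by rintro (s | ⟨⟩) <;> rfl
  right_inv := by rintro (_ | s) <;> rfl

open Classical in
/-- The vertices of `Q`, with `v` as the last index. -/
noncomputable def vertexEquiv (v : V) : {a : V // a ≠ v} ⊕ Unit ≃ V where
  toFun := Sum.elim Subtype.val fun _ => v
  invFun a := if h : a = v then Sum.inr () else Sum.inl ⟨a, h⟩
  left_inv := by
    rintro (⟨a, ha⟩ | ⟨⟩)
    · exact dif_neg ha
    · exact dif_pos rfl
  right_inv a := by
    by_cases h : a = v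
    · simp [h]
    · simp [h]

omit [Fintype S] in
lemma zetaMatrix_withTop [DecidableLE S] [DecidableLE (WithTop S)] :
    (zetaMatrix (WithTop S)).submatrix (withTopEquiv S) (withTopEquiv S) =
      bordered (zetaMatrix S) 1 0 1 := by
  ext (s | ⟨⟩) (t | ⟨⟩) <;> simp [zetaMatrix, withTopEquiv, bordered]

lemma dimMatrix_vertexEquiv (hI : IsTriangular I) :
    (dimMatrix K (vertexIdempotent I)).submatrix (vertexEquiv v) (vertexEquiv v) =
      bordered ((dimMatrix K (vertexIdempotent I)).submatrix Subtype.val Subtype.val)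
        (fun a => dimMatrix K (vertexIdempotent I) a v)
        (fun b => dimMatrix K (vertexIdempotent I) v b) 1 := by
  have hv : dimMatrix K (vertexIdempotent I) v v = 1 := by
    rw [dimMatrix, Matrix.of_apply, hI.isTriangularSystem.finrank_self, Nat.cast_one]
  ext (a | ⟨⟩) (b | ⟨⟩)
  · rfl
  · rfl
  · rfl
  · exact hv

/-- Each poset element inherits the row and column of `v` outside the poset. Within the poset, `⊤`
lies above everything, which accounts for its column of ones and row of zeros. This is the shape
that `pencilDet_insertion` requires. -/
lemma dimMatrix_insertion [DecidableLE S] (hI : IsTriangular I) :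
    (dimMatrix K (vertexIdempotent (insertionIdeal v (WithTop S) I))).submatrix
        (insertionVertexEquiv v S) (insertionVertexEquiv v S) =
      bordered (Matrix.fromBlocks
          ((dimMatrix K (vertexIdempotent I)).submatrix Subtype.val Subtype.val)
          (Matrix.of fun a _ => dimMatrix K (vertexIdempotent I) a.1 v)
          (Matrix.of fun _ b => dimMatrix K (vertexIdempotent I) v b.1) (zetaMatrix S))
        (Sum.elim (fun a => dimMatrix K (vertexIdempotent I) a.1 v) 1)
        (Sum.elim (fun b => dimMatrix K (vertexIdempotent I) v b.1) 0) 1 := by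
  classical
  have key : ∀ x y : InsertionVertex v (WithTop S),
      (∀ s t : WithTop S, x = new v s → y = new v t → s ≤ t) →
      dimMatrix K (vertexIdempotent (insertionIdeal v (WithTop S) I)) x y =
        dimMatrix K (vertexIdempotent I) (collapseVertex x) (collapseVertex y) :=
    fun x y hxy => congrArg Nat.cast (finrank_peirce_insertion hI x y hxy)
  have hnew : ∀ s t : WithTop S,
      dimMatrix K (vertexIdempotent (insertionIdeal v (WithTop S) I)) (new v s) (new v t) =
        if s ≤ t then 1 else 0 := by
    intro s t
    split_ifs with hst
    · rw [key]
      · exact (congrArg Nat.cast (hI.isTriangularSystem.finrank_self v)).trans Nat.cast_one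
      · intro s' t' hs' ht'
        rwa [← Sum.inr_injective hs', ← Sum.inr_injective ht']
    · exact (congrArg Nat.cast (finrank_peirce_insertion_of_not_le hI hst)).trans Nat.cast_zero
  have hold : ∀ (a : Remaining v) (y : InsertionVertex v (WithTop S)),
      dimMatrix K (vertexIdempotent (insertionIdeal v (WithTop S) I)) (old (WithTop S) a) y =
        dimMatrix K (vertexIdempotent I) a.1 (collapseVertex y) :=
    fun a y => key _ _ fun s t hs _ => (Sum.inl_ne_inr hs).elim
  have hold' : ∀ (x : InsertionVertex v (WithTop S)) (b : Remaining v),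
      dimMatrix K (vertexIdempotent (insertionIdeal v (WithTop S) I)) x (old (WithTop S) b) =
        dimMatrix K (vertexIdempotent I) (collapseVertex x) b.1 :=
    fun x b => key _ _ fun s t _ ht => (Sum.inl_ne_inr ht).elim
  ext ((a | s) | ⟨⟩) ((b | t) | ⟨⟩)
  · exact hold a (old _ b)
  · exact hold a _
  · exact hold a _
  · exact hold' _ b
  · refine (hnew s t).trans ?_
    simp [bordered, zetaMatrix]
  · refine (hnew s ⊤).trans ?_
    simp [bordered]
  · exact hold' _ b
  · refine (hnew ⊤ t).trans ?_
    simp [bordered]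
  · refine (hnew ⊤ ⊤).trans ?_
    simp [bordered]

end Matrices

end Triangular

theorem mainTheorem9 {K : Type k} [Field K] {V : Type u} [Fintype V] [Quiver.{w} V]
    (I : TwoSidedIdeal (PathAlgebra K V)) (hI : Triangular.IsTriangular I) (v : V)
    (S : Type s) [PartialOrder S] [Fintype S] :
    Coxeter.coxeterPolynomial K (Triangular.insertion (WithTop S) I v) =
      Coxeter.coxeterPolynomial K (Triangular.quotientAlgebra I) *
          Coxeter.posetCoxeterPolynomial K S +
        Coxeter.coxeterPolynomial K (Triangular.deletion I v) *
          Coxeter.posetCoxeterPolynomial K (WithTop S) -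
        (X + 1) * Coxeter.coxeterPolynomial K (Triangular.deletion I v) *
          Coxeter.posetCoxeterPolynomial K S := by
  classical
  have h1 := (hI.isTriangularSystem_insertion (v := v) (T := WithTop S)).coxeterPolynomial_eq
  have h2 := hI.isTriangularSystem.coxeterPolynomial_eq
  have h3 := (Coxeter.isTriangularSystem_cornerIdempotent hI.isTriangularSystem v)
    |>.coxeterPolynomial_eq
  rw [Coxeter.dimMatrix_cornerIdempotent] at h3
  -- Reindexing with `⊤`, respectively `v`, as last index brings the matrices into bordered form
  -- without changing the determinants.
  rw [← Coxeter.pencilDet_submatrix _ (Triangular.insertionVertexEquiv v S),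
    Triangular.dimMatrix_insertion hI] at h1
  rw [← Coxeter.pencilDet_submatrix _ (Triangular.vertexEquiv v),
    Triangular.dimMatrix_vertexEquiv hI] at h2
  have h4 := Coxeter.posetCoxeterPolynomial_eq K (WithTop S)
  rw [← Coxeter.pencilDet_submatrix _ (Triangular.withTopEquiv S),
    Triangular.zetaMatrix_withTop] at h4
  rw [Coxeter.posetCoxeterPolynomial_eq K S, h4]
  refine (h1.trans (Coxeter.pencilDet_insertion _ _ _ _)).trans ?_
  rw [← h2, ← h3]
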